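/- Let $0<p\le 1$. A $p$-norm on a real vector space is a positive definite, absolutely homogeneous function $\|\cdot\|$ with $\|x+y\|^p\le\|x\|^p+\|y\|^p$. For a metric space $\mathcal N$ with a base point $e$, the Lipschitz free $p$-space $\mathcal F_p(\mathcal N)$ is the completion of the space of formal finite combinations $\sum_x a_x\delta(x)$, $x\in\mathcal N$, under $\|\sum_x a_x\delta(x)\|=\sup\|\sum_x a_x f(x)\|_Y$, the supremum being taken over all $p$-normed spaces $Y$ and all $1$-Lipschitz maps $f:\mathcal N\to Y$ with $f(e)=0$ (combinations of norm zero are identified with $0$). For a $p$-normed space $X$, $\ell_p(X)$ is the space of sequences $(x_n)_{n\in\mathbb N}$ in $X$ with $\|(x_n)\|=(\sum_n\|x_n\|^p)^{1/p}<\infty$, and $X\simeq Y$ means that there is a linear bijection $X\to Y$ that is bounded together with its inverse. Let $(\mathcal M,d,0)$ be a pointed metric space which is doubling (there is $D\in\mathbb N$ such that every ball of radius $r>0$ can be covered by at most $D$ balls of radius $r/2$) and self-similar (there are $R>1$ and a bijection $f:\mathcal M\to\mathcal M$ with $d(f(x),f(y))=R\,d(x,y)$ for all $x,y\in\mathcal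 M$ and $f(0)=0$). Let $\mathcal N\subset\mathcal M$ be a net in $\mathcal M$, i.e. a subset which for some $a,b>0$ is $a$-separated and $b$-dense in $\mathcal M$. Then for every $p\in(0,1]$ (and every choice of a base point in $\mathcal N$), $$\mathcal F_p(\mathcal N)\simeq \ell_p(\mathcal F_p(\mathcal N)).$$ In particular, this holds for every net $\mathcal N$ in a finite-dimensional real normed space, and $\mathcal F_p(\mathbb Z^d)\simeq\ell_p(\mathcal F_p(\mathbb Z^d))$ for every $d$ and every $p\in(0,1]$, where $\mathbb Z^d$ carries either the Euclidean or the maximum metric. -/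

import Mathlib

universe u

noncomputable section

/-! ### Quasi-norms, `p`-norms and isomorphisms -/

/-- A (quasi-)norm function on a type, as bare data. -/
class QNorm (X : Type*) where
  /-- The quasi-norm. -/
  qnorm : X → ℝ

/-- `X`, with its quasi-norm, is a `p`-normed real vector space, `0 < p ≤ 1`: the quasi-norm is
positive definite, absolutely homogeneous, and satisfies `‖x + y‖ ^ p ≤ ‖x‖ ^ p + ‖y‖ ^ p`. -/
class PNormedSpace (p : Set.Ioc (0 : ℝ) 1) (X : Type*) [AddCommGroup X] [Module ℝ X] [QNorm X] :
    Prop where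
  qnorm_nonneg : ∀ x : X, 0 ≤ QNorm.qnorm x
  eq_zero_of_qnorm_eq_zero : ∀ x : X, QNorm.qnorm x = 0 → x = 0
  qnorm_smul : ∀ (a : ℝ) (x : X), QNorm.qnorm (a • x) = |a| * QNorm.qnorm x
  qnorm_add_rpow_le : ∀ x y : X, QNorm.qnorm (x + y) ^ (p : ℝ) ≤
    QNorm.qnorm x ^ (p : ℝ) + QNorm.qnorm y ^ (p : ℝ)

/-- Two quasi-normed spaces are isomorphic: there are mutually inverse linear maps between them
which are both bounded. -/
def QIsomorphic (X Y : Type*) [AddCommGroup X] [Module ℝ X] [QNorm X]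
    [AddCommGroup Y] [Module ℝ Y] [QNorm Y] : Prop :=
  ∃ (S : X →ₗ[ℝ] Y) (T : Y →ₗ[ℝ] X), T ∘ₗ S = LinearMap.id ∧ S ∘ₗ T = LinearMap.id ∧
    (∃ C : ℝ, ∀ x, QNorm.qnorm (S x) ≤ C * QNorm.qnorm x) ∧
    (∃ C : ℝ, ∀ y, QNorm.qnorm (T y) ≤ C * QNorm.qnorm y)

section PNormed

variable (p : Set.Ioc (0 : ℝ) 1)

theorem PNormedSpace.qnorm_zero (X : Type*) [AddCommGroup X] [Module ℝ X] [QNorm X]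
    [PNormedSpace p X] : QNorm.qnorm (0 : X) = 0 := by
  have h := PNormedSpace.qnorm_smul p (0 : ℝ) (0 : X)
  simpa using h

theorem PNormedSpace.qnorm_sum_rpow_le {X : Type*} [AddCommGroup X] [Module ℝ X] [QNorm X]
    [PNormedSpace p X] {ι : Type*} (s : Finset ι) (g : ι → X) :
    QNorm.qnorm (∑ i ∈ s, g i) ^ (p : ℝ) ≤ ∑ i ∈ s, QNorm.qnorm (g i) ^ (p : ℝ) := by
  classical
  induction s using Finset.induction_on with
  | empty => simp [PNormedSpace.qnorm_zero p X, Real.zero_rpow p.2.1.ne']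
  | insert i s hi ih =>
    rw [Finset.sum_insert hi, Finset.sum_insert hi]
    exact (PNormedSpace.qnorm_add_rpow_le _ _).trans (by gcongr)

/-! ### The `ℓ_p`-sum of countably many copies of a `p`-normed space -/

/-- The vector space of the sequences `(x n)` in `X` with `∑ ‖x n‖ ^ p < ∞`. -/
def LpSum (X : Type*) [AddCommGroup X] [Module ℝ X] [QNorm X] [PNormedSpace p X] :
    Submodule ℝ (ℕ → X) where
  carrier := {x | Summable fun n => QNorm.qnorm (x n) ^ (p : ℝ)}
  zero_mem' := by
    simp [PNormedSpace.qnorm_zero p X, Real.zero_rpow p.2.1.ne']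
  add_mem' := by
    intro x y hx hy
    exact Summable.of_nonneg_of_le
      (fun n => Real.rpow_nonneg (PNormedSpace.qnorm_nonneg p _) _)
      (fun n => PNormedSpace.qnorm_add_rpow_le (x n) (y n)) (hx.add hy)
  smul_mem' := by
    intro a x hx
    have h : (fun n => QNorm.qnorm ((a • x) n) ^ (p : ℝ)) =
        fun n => |a| ^ (p : ℝ) * QNorm.qnorm (x n) ^ (p : ℝ) := by
      funext n
      rw [Pi.smul_apply, PNormedSpace.qnorm_smul p,
        Real.mul_rpow (abs_nonneg a) (PNormedSpace.qnorm_nonneg p _)]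
    change Summable _
    rw [h]
    exact Summable.mul_left _ hx

/-- The quasi-norm `‖x‖ = (∑ ‖x n‖ ^ p) ^ (1 / p)` of the `ℓ_p`-sum. -/
instance LpSum.instQNorm (X : Type*) [AddCommGroup X] [Module ℝ X] [QNorm X]
    [PNormedSpace p X] : QNorm (LpSum p X) where
  qnorm x := (∑' n, QNorm.qnorm ((x : ℕ → X) n) ^ (p : ℝ)) ^ (1 / (p : ℝ))

/-! ### The Lipschitz free `p`-space over a pointed metric space -/

variable {M : Type u} [MetricSpace M]

/-- All the values `‖∑ μ x • f x‖`, where `f` is a `1`-Lipschitz map from `M` into a `p`-normed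
space `Y` which vanishes at the base point `o`. (Only the linear span of the range of `f` matters,
so it is enough to take `Y` in the universe of `M`.) -/
def freeValues (o : M) (μ : M →₀ ℝ) : Set ℝ :=
  {r | ∃ (Y : Type u) (_ : AddCommGroup Y) (_ : Module ℝ Y) (_ : QNorm Y)
    (_ : PNormedSpace p Y) (f : M → Y), f o = 0 ∧
    (∀ x y, QNorm.qnorm (f x - f y) ≤ dist x y) ∧
    r = QNorm.qnorm (Finsupp.linearCombination ℝ f μ)}

/-- The `p`-seminorm `‖∑ μ x • δ x‖ = sup ‖∑ μ x • f x‖_Y` on the formal linear combinations of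
the points of `M`, the supremum being taken over all `p`-normed spaces `Y` and all `1`-Lipschitz
maps `f : M → Y` which vanish at the base point `o`. -/
def freePNorm (o : M) (μ : M →₀ ℝ) : ℝ := sSup (freeValues p o μ)

theorem freeValues_nonneg (o : M) (μ : M →₀ ℝ) {r : ℝ} (hr : r ∈ freeValues p o μ) : 0 ≤ r := by
  obtain ⟨Y, _, _, _, _, f, -, -, rfl⟩ := hr
  exact PNormedSpace.qnorm_nonneg p _

theorem freeValues_bddAbove (o : M) (μ : M →₀ ℝ) : BddAbove (freeValues p o μ) := by
  refine ⟨(∑ x ∈ μ.support, (|μ x| * dist x o) ^ (p : ℝ)) ^ (1 / (p : ℝ)), ?_⟩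
  rintro r ⟨Y, _, _, _, _, f, hf0, hf, rfl⟩
  have hn := PNormedSpace.qnorm_nonneg p (Finsupp.linearCombination ℝ f μ)
  have key : QNorm.qnorm (Finsupp.linearCombination ℝ f μ) ^ (p : ℝ) ≤
      ∑ x ∈ μ.support, (|μ x| * dist x o) ^ (p : ℝ) := by
    rw [Finsupp.linearCombination_apply, Finsupp.sum]
    refine (PNormedSpace.qnorm_sum_rpow_le p _ _).trans (Finset.sum_le_sum fun x _ => ?_)
    refine Real.rpow_le_rpow (PNormedSpace.qnorm_nonneg p _) ?_ p.2.1.le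
    rw [PNormedSpace.qnorm_smul p]
    have := hf x o
    rw [hf0, sub_zero] at this
    gcongr
  rw [one_div]
  exact (Real.le_rpow_inv_iff_of_pos hn ((Real.rpow_nonneg hn _).trans key) p.2.1).2 key

theorem freePNorm_nonneg (o : M) (μ : M →₀ ℝ) : 0 ≤ freePNorm p o μ :=
  Real.sSup_nonneg fun _ hr => freeValues_nonneg p o μ hr

theorem freePNorm_zero (o : M) : freePNorm p o 0 = 0 := by
  refine le_antisymm (Real.sSup_le ?_ le_rfl) (freePNorm_nonneg p o 0)
  rintro r ⟨Y, _, _, _, _, f, -, -, rfl⟩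
  rw [map_zero, PNormedSpace.qnorm_zero p Y]

theorem freePNorm_smul_le (o : M) (a : ℝ) (μ : M →₀ ℝ) :
    freePNorm p o (a • μ) ≤ |a| * freePNorm p o μ := by
  refine Real.sSup_le ?_ (mul_nonneg (abs_nonneg a) (freePNorm_nonneg p o μ))
  rintro r ⟨Y, i₁, i₂, i₃, i₄, f, hf0, hf, rfl⟩
  rw [map_smul, PNormedSpace.qnorm_smul p]
  gcongr
  exact le_csSup (freeValues_bddAbove p o μ) ⟨Y, i₁, i₂, i₃, i₄, f, hf0, hf, rfl⟩

theorem freePNorm_smul (o : M) (a : ℝ) (μ : M →₀ ℝ) :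
    freePNorm p o (a • μ) = |a| * freePNorm p o μ := by
  refine le_antisymm (freePNorm_smul_le p o a μ) ?_
  rcases eq_or_ne a 0 with rfl | ha
  · simp [freePNorm_zero]
  · have h := freePNorm_smul_le p o a⁻¹ (a • μ)
    rw [inv_smul_smul₀ ha, abs_inv] at h
    have ha' : 0 < |a| := abs_pos.2 ha
    rwa [inv_mul_eq_div, le_div_iff₀' ha'] at h

theorem freePNorm_neg (o : M) (μ : M →₀ ℝ) : freePNorm p o (-μ) = freePNorm p o μ := by
  have h := freePNorm_smul p o (-1) μ
  rwa [neg_one_smul, abs_neg, abs_one, one_mul] at h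

theorem freePNorm_add_rpow_le (o : M) (μ ν : M →₀ ℝ) :
    freePNorm p o (μ + ν) ^ (p : ℝ) ≤ freePNorm p o μ ^ (p : ℝ) + freePNorm p o ν ^ (p : ℝ) := by
  have hB : 0 ≤ freePNorm p o μ ^ (p : ℝ) + freePNorm p o ν ^ (p : ℝ) :=
    add_nonneg (Real.rpow_nonneg (freePNorm_nonneg p o μ) _)
      (Real.rpow_nonneg (freePNorm_nonneg p o ν) _)
  refine (Real.le_rpow_inv_iff_of_pos (freePNorm_nonneg p o _) hB p.2.1).1 ?_
  refine Real.sSup_le ?_ (Real.rpow_nonneg hB _)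
  rintro r ⟨Y, i₁, i₂, i₃, i₄, f, hf0, hf, rfl⟩
  refine (Real.le_rpow_inv_iff_of_pos (PNormedSpace.qnorm_nonneg p _) hB p.2.1).2 ?_
  rw [map_add]
  refine (PNormedSpace.qnorm_add_rpow_le _ _).trans (add_le_add ?_ ?_) <;>
  refine Real.rpow_le_rpow (PNormedSpace.qnorm_nonneg p _) ?_ p.2.1.le
  · exact le_csSup (freeValues_bddAbove p o μ) ⟨Y, i₁, i₂, i₃, i₄, f, hf0, hf, rfl⟩
  · exact le_csSup (freeValues_bddAbove p o ν) ⟨Y, i₁, i₂, i₃, i₄, f, hf0, hf, rfl⟩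

/-- The formal linear combinations of points of `M`, to be equipped with the translation-invariant
(semi)metric `‖μ - ν‖ ^ p` of the `p`-seminorm `freePNorm p o`. -/
def PreFree (_p : Set.Ioc (0 : ℝ) 1) (_o : M) : Type u := M →₀ ℝ

instance PreFree.instAddCommGroup (o : M) : AddCommGroup (PreFree p o) :=
  inferInstanceAs (AddCommGroup (M →₀ ℝ))

instance PreFree.instModule (o : M) : Module ℝ (PreFree p o) :=
  inferInstanceAs (Module ℝ (M →₀ ℝ))

/-- Here `‖μ‖` is the `p`-th power of the `p`-seminorm of `μ`; this power is subadditive. -/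
instance PreFree.instSeminormedAddCommGroup (o : M) : SeminormedAddCommGroup (PreFree p o) :=
  AddGroupSeminorm.toSeminormedAddCommGroup
    { toFun := fun μ : PreFree p o => freePNorm p o μ ^ (p : ℝ)
      map_zero' := (congrArg (· ^ (p : ℝ)) (freePNorm_zero p o)).trans
        (Real.zero_rpow p.2.1.ne')
      add_le' := fun μ ν => freePNorm_add_rpow_le p o μ ν
      neg' := fun μ => congrArg (· ^ (p : ℝ)) (freePNorm_neg p o μ) }

theorem PreFree.norm_def (o : M) (μ : PreFree p o) : ‖μ‖ = freePNorm p o μ ^ (p : ℝ) := rfl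

theorem PreFree.norm_smul (o : M) (a : ℝ) (μ : PreFree p o) :
    ‖a • μ‖ = |a| ^ (p : ℝ) * ‖μ‖ := by
  rw [PreFree.norm_def, PreFree.norm_def,
    ← Real.mul_rpow (abs_nonneg a) (freePNorm_nonneg p o μ)]
  exact congrArg (· ^ (p : ℝ)) (freePNorm_smul p o a μ)

instance PreFree.instUniformContinuousConstSMul (o : M) :
    UniformContinuousConstSMul ℝ (PreFree p o) where
  uniformContinuous_const_smul a := by
    refine (LipschitzWith.of_dist_le_mul (K := ⟨|a| ^ (p : ℝ), by positivity⟩)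
      fun μ ν => ?_).uniformContinuous
    rw [dist_eq_norm, dist_eq_norm, ← smul_sub, PreFree.norm_smul]
    rfl

/-- The Lipschitz free `p`-space over the metric space `M` with base point `o`: the completion of
the linear combinations of points of `M` with respect to the `p`-seminorm `freePNorm p o`. (The
completion is separated: the combinations of seminorm zero, such as the base point, become `0`.) -/
abbrev FreePSpace (o : M) : Type u := UniformSpace.Completion (PreFree p o)

/-- The `p`-norm of the Lipschitz free `p`-space. Here `‖x‖` is the extension to the completion of
the `p`-th power of `freePNorm p o`. -/
instance FreePSpace.instQNorm (o : M) : QNorm (FreePSpace p o) where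
  qnorm x := ‖x‖ ^ (1 / (p : ℝ))

theorem FreePSpace.norm_smul (o : M) (a : ℝ) (x : FreePSpace p o) :
    ‖a • x‖ = |a| ^ (p : ℝ) * ‖x‖ := by
  induction x using UniformSpace.Completion.induction_on with
  | hp =>
    exact isClosed_eq (continuous_norm.comp (continuous_const_smul a))
      (continuous_const.mul continuous_norm)
  | ih μ =>
    rw [← UniformSpace.Completion.coe_smul, UniformSpace.Completion.norm_coe,
      UniformSpace.Completion.norm_coe, PreFree.norm_smul]

instance FreePSpace.instPNormedSpace (o : M) : PNormedSpace p (FreePSpace p o) where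
  qnorm_nonneg x := Real.rpow_nonneg (norm_nonneg x) _
  eq_zero_of_qnorm_eq_zero x hx := by
    have h := (Real.rpow_eq_zero (norm_nonneg x) (one_div_ne_zero p.2.1.ne')).1 hx
    exact norm_eq_zero.1 h
  qnorm_smul a x := by
    change ‖a • x‖ ^ (1 / (p : ℝ)) = |a| * ‖x‖ ^ (1 / (p : ℝ))
    rw [FreePSpace.norm_smul, Real.mul_rpow (by positivity) (norm_nonneg x),
      ← Real.rpow_mul (abs_nonneg a), mul_one_div_cancel p.2.1.ne', Real.rpow_one]
  qnorm_add_rpow_le x y := by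
    have h : ∀ z : FreePSpace p o, (‖z‖ ^ (1 / (p : ℝ))) ^ (p : ℝ) = ‖z‖ := fun z => by
      rw [← Real.rpow_mul (norm_nonneg z), one_div_mul_cancel p.2.1.ne', Real.rpow_one]
    change (‖x + y‖ ^ (1 / (p : ℝ))) ^ (p : ℝ) ≤
      (‖x‖ ^ (1 / (p : ℝ))) ^ (p : ℝ) + (‖y‖ ^ (1 / (p : ℝ))) ^ (p : ℝ)
    rw [h, h, h]
    exact norm_add_le x y

end PNormed

/-! ### Metric notions -/

/-- A metric space is doubling if for some `D` every ball of radius `r > 0` is covered by at most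
`D` balls of radius `r / 2`. -/
def IsDoublingSpace (M : Type*) [MetricSpace M] : Prop :=
  ∃ D : ℕ, ∀ (x : M) (r : ℝ), 0 < r → ∃ s : Finset M, s.card ≤ D ∧
    Metric.closedBall x r ⊆ ⋃ y ∈ s, Metric.closedBall y (r / 2)

/-- A metric space with base point `o` is self-similar if for some `R > 1` there is a bijection `f`
with `dist (f x) (f y) = R * dist x y` and `f o = o`. -/
def IsSelfSimilar {M : Type*} [MetricSpace M] (o : M) : Prop :=
  ∃ R : ℝ, 1 < R ∧ ∃ f : M → M, Function.Bijective f ∧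
    (∀ x y, dist (f x) (f y) = R * dist x y) ∧ f o = o

/-- A net in a metric space is a subset which is `a`-separated and `b`-dense for some
`a, b > 0`. -/
def IsMetricNet {M : Type*} [MetricSpace M] (N : Set M) : Prop :=
  ∃ a b : ℝ, 0 < a ∧ 0 < b ∧ (∀ x ∈ N, ∀ y ∈ N, x ≠ y → a ≤ dist x y) ∧
    ∀ x : M, ∃ y ∈ N, dist x y ≤ b

/-- The points with integer coordinates in Euclidean space. -/
def euclideanIntLattice (d : ℕ) : Set (EuclideanSpace ℝ (Fin d)) :=
  {x | ∀ i, ∃ n : ℤ, x i = n}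

end

/-! Write X for the free `p`-space over the net `N`. By Pełczyński's decomposition method
(`qisomorphic_lpSum_of_complemented`) it is enough to realize ℓ_p(X) as a complemented subspace of
X. This amounts to operators S_n, T_n on X with T_m S_n = δ_{mn} id, the S_n uniformly bounded and ∑
‖T_n v‖^p ≤ C ‖v‖^p (`FreePSpace.qisomorphic_lpSum`).

Self-similarity provides the room for infinitely many copies. Cut the net into dyadic annuli around
the centre. For the k-th annulus of the n-th copy put j = pair(n, k), dilate by a power λ_j of R,
round to the net and divide by λ_j. The λ_j grow so fast that the images for different j lie in
disjoint, sparse annuli. S_n glues these maps along a dyadic partition of unity; T_n cuts out the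
image annuli of the n-th copy, contracts back and multiplies by λ_j.

Contracting leads to points of `M` outside the net, so T_n needs a Lipschitz extension r of δ to
`M`. Doubling gives it, through a partition of unity of bounded multiplicity
(`IsDoublingSpace.exists_extend_freeDelta`). Since r is constant near each net point, it absorbs the
rounding error, and T_m S_n is the identity or zero exactly, not just approximately.

The estimates survive for p < 1 because at most a fixed number of terms is nonzero at each point, so
the `p`-triangle inequality costs a constant (`exists_glued_family`). Cutting off is harmless since
the maps vanish at the base point and the cutoffs vary on the scale of the distance to it. -/

noncomputable section

/-! ### Universal property of the free `p`-space, for single maps and for sequences of maps. -/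

section FreeSpace

variable (p : Set.Ioc (0 : ℝ) 1)

section LpSum

variable {X : Type*} [AddCommGroup X] [Module ℝ X] [QNorm X] [PNormedSpace p X]

theorem LpSum.qnorm_rpow (w : LpSum p X) :
    QNorm.qnorm w ^ (p : ℝ) = ∑' n, QNorm.qnorm ((w : ℕ → X) n) ^ (p : ℝ) := by
  change ((∑' n, QNorm.qnorm ((w : ℕ → X) n) ^ (p : ℝ)) ^ (1 / (p : ℝ))) ^ (p : ℝ) = _
  rw [← Real.rpow_mul, one_div_mul_cancel p.2.1.ne', Real.rpow_one]
  exact tsum_nonneg fun n => Real.rpow_nonneg (PNormedSpace.qnorm_nonneg p _) _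

theorem LpSum.qnorm_nonneg (w : LpSum p X) : 0 ≤ QNorm.qnorm w :=
  Real.rpow_nonneg (tsum_nonneg fun _ => Real.rpow_nonneg (PNormedSpace.qnorm_nonneg p _) _) _

/-- Makes the ℓ_p-sum an admissible target in the supremum that defines the free `p`-norm; this is
what turns a sequence of Lipschitz maps into a single one. -/
instance LpSum.instPNormedSpace : PNormedSpace p (LpSum p X) where
  qnorm_nonneg := LpSum.qnorm_nonneg p
  eq_zero_of_qnorm_eq_zero w hw := by
    have h := LpSum.qnorm_rpow p w
    rw [hw, Real.zero_rpow p.2.1.ne'] at h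
    have h0 := (hasSum_zero_iff_of_nonneg
      fun n => Real.rpow_nonneg (PNormedSpace.qnorm_nonneg p ((w : ℕ → X) n)) (p : ℝ)).1
      (w.2.hasSum_iff.2 h.symm)
    ext1; funext n
    refine PNormedSpace.eq_zero_of_qnorm_eq_zero p _ ?_
    exact (Real.rpow_eq_zero (PNormedSpace.qnorm_nonneg p _) p.2.1.ne').1 (congrFun h0 n)
  qnorm_smul a w := by
    refine (Real.rpow_left_inj (LpSum.qnorm_nonneg p _)
      (mul_nonneg (abs_nonneg a) (LpSum.qnorm_nonneg p w)) p.2.1.ne').1 ?_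
    rw [Real.mul_rpow (abs_nonneg a) (LpSum.qnorm_nonneg p w), LpSum.qnorm_rpow,
      LpSum.qnorm_rpow, ← tsum_mul_left]
    refine tsum_congr fun n => ?_
    rw [← Real.mul_rpow (abs_nonneg a) (PNormedSpace.qnorm_nonneg p _)]
    exact congrArg (· ^ (p : ℝ)) (PNormedSpace.qnorm_smul p a _)
  qnorm_add_rpow_le w w' := by
    rw [LpSum.qnorm_rpow, LpSum.qnorm_rpow, LpSum.qnorm_rpow,
      ← Summable.tsum_add w.2 w'.2]
    exact Summable.tsum_le_tsum (fun n => PNormedSpace.qnorm_add_rpow_le _ _)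
      (w + w').2 (w.2.add w'.2)

end LpSum

variable {N : Type u} [MetricSpace N] (e : N)

/-- The bars denote the p-th power of the `p`-norm, which satisfies the ordinary triangle
inequality. Estimates in the free space are stated in these terms, with distances raised to the
power p. -/
theorem FreePSpace.qnorm_rpow (v : FreePSpace p e) : QNorm.qnorm v ^ (p : ℝ) = ‖v‖ := by
  change (‖v‖ ^ (1 / (p : ℝ))) ^ (p : ℝ) = ‖v‖
  rw [← Real.rpow_mul (norm_nonneg v), one_div_mul_cancel p.2.1.ne', Real.rpow_one]

/-- The canonical map from the formal linear combinations to the Lipschitz free `p`-space. -/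
def freeMk : (N →₀ ℝ) →ₗ[ℝ] FreePSpace p e where
  toFun μ := UniformSpace.Completion.coe' (α := PreFree p e) μ
  map_add' μ ν := UniformSpace.Completion.coe_add (α := PreFree p e) μ ν
  map_smul' a μ := UniformSpace.Completion.coe_smul (X := PreFree p e) a μ

theorem norm_freeMk (μ : N →₀ ℝ) : ‖freeMk p e μ‖ = freePNorm p e μ ^ (p : ℝ) :=
  UniformSpace.Completion.norm_coe (E := PreFree p e) μ

theorem freeMk_induction {P : FreePSpace p e → Prop} (hP : IsClosed {v | P v})
    (h : ∀ μ, P (freeMk p e μ)) (v : FreePSpace p e) : P v :=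
  UniformSpace.Completion.induction_on (α := PreFree p e) v hP h

/-- The canonical image of a point of `N` in the Lipschitz free `p`-space. -/
def freeDelta (x : N) : FreePSpace p e := freeMk p e (Finsupp.single x 1)

theorem norm_freeDelta_sub_le (x y : N) :
    ‖freeDelta p e x - freeDelta p e y‖ ≤ dist x y ^ (p : ℝ) := by
  rw [freeDelta, freeDelta, ← map_sub, norm_freeMk]
  refine Real.rpow_le_rpow (freePNorm_nonneg p e _) ?_ p.2.1.le
  refine Real.sSup_le ?_ dist_nonneg
  rintro r ⟨Y, _, _, _, _, f, -, hf, rfl⟩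
  simpa [map_sub] using hf x y

theorem freeDelta_base : freeDelta p e e = 0 := by
  rw [← norm_eq_zero, freeDelta, norm_freeMk]
  have h : freePNorm p e (Finsupp.single e (1 : ℝ)) ≤ 0 := by
    refine Real.sSup_le ?_ le_rfl
    rintro r ⟨Y, _, _, _, _, f, hf0, -, rfl⟩
    simp [hf0, PNormedSpace.qnorm_zero p Y]
  rw [le_antisymm h (freePNorm_nonneg p e _), Real.zero_rpow p.2.1.ne']

/-- Rescaled by C^(-1/p), the map `f` becomes 1-Lipschitz and competes in the supremum. -/
theorem qnorm_linearCombination_le {Y : Type u} [AddCommGroup Y] [Module ℝ Y] [QNorm Y]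
    [PNormedSpace p Y] (f : N → Y) (hf0 : f e = 0) {C : ℝ} (hC : 0 < C)
    (hf : ∀ x y, QNorm.qnorm (f x - f y) ^ (p : ℝ) ≤ C * dist x y ^ (p : ℝ)) (μ : N →₀ ℝ) :
    QNorm.qnorm (Finsupp.linearCombination ℝ f μ) ^ (p : ℝ) ≤ C * freePNorm p e μ ^ (p : ℝ) := by
  have hp := p.2.1
  set c : ℝ := C ^ (1 / (p : ℝ)) with hc
  have hc0 : 0 < c := Real.rpow_pos_of_pos hC _
  have hcp : c ^ (p : ℝ) = C := by
    rw [hc, ← Real.rpow_mul hC.le, one_div_mul_cancel hp.ne', Real.rpow_one]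
  have key : QNorm.qnorm (Finsupp.linearCombination ℝ f μ) ≤ c * freePNorm p e μ := by
    have hmem : c⁻¹ * QNorm.qnorm (Finsupp.linearCombination ℝ f μ) ∈ freeValues p e μ := by
      refine ⟨Y, _, _, _, ‹_›, fun x => c⁻¹ • f x, by simp [hf0], fun x y => ?_, ?_⟩
      · rw [← smul_sub, PNormedSpace.qnorm_smul p, abs_of_pos (inv_pos.2 hc0),
          inv_mul_le_iff₀ hc0]
        refine (Real.rpow_le_rpow_iff (PNormedSpace.qnorm_nonneg p _) (by positivity) hp).1 ?_
        rw [Real.mul_rpow hc0.le dist_nonneg, hcp]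
        exact hf x y
      · have h : Finsupp.linearCombination ℝ (fun x => c⁻¹ • f x) μ =
            c⁻¹ • Finsupp.linearCombination ℝ f μ := by
          simp only [Finsupp.linearCombination_apply, Finsupp.sum, Finset.smul_sum]
          exact Finset.sum_congr rfl fun x _ => smul_comm _ _ _
        rw [h, PNormedSpace.qnorm_smul p, abs_of_pos (inv_pos.2 hc0)]
    have := le_csSup (freeValues_bddAbove p e μ) hmem
    rwa [inv_mul_le_iff₀ hc0] at this
  refine (Real.rpow_le_rpow (PNormedSpace.qnorm_nonneg p _) key hp.le).trans ?_
  rw [Real.mul_rpow hc0.le (freePNorm_nonneg p e μ), hcp]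

variable {p e}

/-- The point masses span a dense subspace, so identities between operators need checking only
there. -/
theorem FreePSpace.ext_clm {f g : FreePSpace p e →L[ℝ] FreePSpace p e}
    (h : ∀ x, f (freeDelta p e x) = g (freeDelta p e x)) : f = g := by
  have key : f.toLinearMap ∘ₗ freeMk p e = g.toLinearMap ∘ₗ freeMk p e :=
    Finsupp.lhom_ext' fun x => LinearMap.ext_ring (h x)
  ext v
  refine freeMk_induction p e (isClosed_eq f.continuous g.continuous) (fun μ => ?_) v
  exact LinearMap.congr_fun key μ

theorem FreePSpace.exists_extension (f : N → FreePSpace p e) (hf0 : f e = 0) {C : ℝ}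
    (hC : 0 < C) (hf : ∀ x y, ‖f x - f y‖ ≤ C * dist x y ^ (p : ℝ)) :
    ∃ T : FreePSpace p e →L[ℝ] FreePSpace p e,
      ∀ μ : N →₀ ℝ, T (freeMk p e μ) = Finsupp.linearCombination ℝ f μ := by
  let L : PreFree p e →ₗ[ℝ] FreePSpace p e := Finsupp.linearCombination ℝ f
  have hL : ∀ μ : PreFree p e, ‖L μ‖ ≤ C * ‖μ‖ := fun μ => by
    rw [← FreePSpace.qnorm_rpow, PreFree.norm_def]
    refine qnorm_linearCombination_le p e f hf0 hC (fun x y => ?_) μ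
    rw [FreePSpace.qnorm_rpow]
    exact hf x y
  let L' : PreFree p e →L[ℝ] FreePSpace p e :=
    ⟨L, AddMonoidHomClass.continuous_of_bound L C hL⟩
  have hT : ∀ μ : PreFree p e, L'.fromCompletion (μ : FreePSpace p e) = L μ := fun μ => by
    simp [L']
  exact ⟨L'.fromCompletion, hT⟩

/-- A sequence of maps on `N` which is jointly Lipschitz with respect to the `ℓ_p`-sum extends to a
jointly bounded sequence of operators on the Lipschitz free `p`-space. -/
theorem FreePSpace.exists_extension_family (f : ℕ → N → FreePSpace p e) (hf0 : ∀ n, f n e = 0)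
    {C : ℝ} (hC : 0 < C)
    (hf : ∀ (F : Finset ℕ) (x y), ∑ n ∈ F, ‖f n x - f n y‖ ≤ C * dist x y ^ (p : ℝ)) :
    ∃ T : ℕ → FreePSpace p e →L[ℝ] FreePSpace p e,
      (∀ n x, T n (freeDelta p e x) = f n x) ∧
        ∀ (F : Finset ℕ) v, ∑ n ∈ F, ‖T n v‖ ≤ C * ‖v‖ := by
  classical
  have h1 : ∀ n x y, ‖f n x - f n y‖ ≤ C * dist x y ^ (p : ℝ) := fun n x y => by
    simpa using hf {n} x y
  choose T hT using fun n => FreePSpace.exists_extension (f n) (hf0 n) hC (h1 n)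
  refine ⟨T, fun n x => ?_, fun F v => ?_⟩
  · refine (hT n (Finsupp.single x 1)).trans ?_
    rw [Finsupp.linearCombination_single, one_smul]
  have hmem : ∀ w : ℕ → FreePSpace p e,
      (fun n => if n ∈ F then w n else 0) ∈ LpSum p (FreePSpace p e) := fun w => by
    refine summable_of_ne_finset_zero (s := F) fun n hn => ?_
    simp only [if_neg hn, PNormedSpace.qnorm_zero p, Real.zero_rpow p.2.1.ne']
  -- Truncation to `F` makes every sequence p-summable. The joint bound is then the universal
  -- property applied to one map into the ℓ_p-sum, with a constant independent of `F`.
  let R : (ℕ → FreePSpace p e) →ₗ[ℝ] LpSum p (FreePSpace p e) :=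
    { toFun := fun w => ⟨_, hmem w⟩
      map_add' := fun w w' => by
        ext1; funext n
        by_cases hn : n ∈ F <;> simp [hn]
      map_smul' := fun a w => by
        ext1; funext n
        by_cases hn : n ∈ F <;> simp [hn] }
  have hR : ∀ w, QNorm.qnorm (R w) ^ (p : ℝ) = ∑ n ∈ F, ‖w n‖ := fun w => by
    rw [LpSum.qnorm_rpow]
    simp only [FreePSpace.qnorm_rpow]
    rw [tsum_eq_sum (s := F) fun n hn => by simp [R, hn]]
    exact Finset.sum_congr rfl fun n hn => by simp [R, hn]
  refine freeMk_induction p e (P := fun v => ∑ n ∈ F, ‖T n v‖ ≤ C * ‖v‖)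
    (isClosed_le (by fun_prop) (by fun_prop)) (fun μ => ?_) v
  have key := qnorm_linearCombination_le p e (fun x => R fun n => f n x)
    (by simp only [hf0]; exact map_zero R) hC (fun x y => by
      rw [← map_sub, hR]
      exact hf F x y) μ
  have hsum : Finsupp.linearCombination ℝ (fun x => R fun n => f n x) μ =
      R fun n => T n (freeMk p e μ) := by
    have : (fun n => T n (freeMk p e μ)) =
        Finsupp.linearCombination ℝ (fun x n => f n x) μ := by
      funext n
      rw [hT, Finsupp.linearCombination_apply, Finsupp.linearCombination_apply, Finsupp.sum,
        Finsupp.sum, Finset.sum_apply]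
      rfl
    rw [this, Finsupp.linearCombination_apply, Finsupp.linearCombination_apply,
      map_finsuppSum]
    simp only [map_smul]
  rwa [hsum, hR, ← norm_freeMk] at key

end FreeSpace

/-! ### Bounded maps on ℓ_p-sums and the decomposition method. -/

section Decomposition

variable (p : Set.Ioc (0 : ℝ) 1)

/-- Boundedness of a linear map between `p`-normed spaces, in terms of the `p`-th powers of the
`p`-norms. -/
def IsQBounded {X Y : Type*} [AddCommGroup X] [Module ℝ X] [QNorm X]
    [AddCommGroup Y] [Module ℝ Y] [QNorm Y] (A : X →ₗ[ℝ] Y) : Prop :=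
  ∃ C : ℝ, 0 ≤ C ∧ ∀ x, QNorm.qnorm (A x) ^ (p : ℝ) ≤ C * QNorm.qnorm x ^ (p : ℝ)

section

variable {p} {X Y Z : Type*} [AddCommGroup X] [Module ℝ X] [QNorm X]
  [AddCommGroup Y] [Module ℝ Y] [QNorm Y] [AddCommGroup Z] [Module ℝ Z] [QNorm Z]

theorem isQBounded_id : IsQBounded p (LinearMap.id : X →ₗ[ℝ] X) :=
  ⟨1, zero_le_one, fun x => by simp⟩

theorem IsQBounded.comp {B : Y →ₗ[ℝ] Z} {A : X →ₗ[ℝ] Y} (hB : IsQBounded p B)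
    (hA : IsQBounded p A) : IsQBounded p (B ∘ₗ A) := by
  obtain ⟨C, hC, h⟩ := hA
  obtain ⟨C', hC', h'⟩ := hB
  refine ⟨C' * C, mul_nonneg hC' hC, fun x => (h' _).trans ?_⟩
  rw [mul_assoc]
  exact mul_le_mul_of_nonneg_left (h x) hC'

variable [PNormedSpace p Y]

theorem IsQBounded.add {A B : X →ₗ[ℝ] Y} (hA : IsQBounded p A) (hB : IsQBounded p B) :
    IsQBounded p (A + B) := by
  obtain ⟨C, hC, h⟩ := hA
  obtain ⟨C', hC', h'⟩ := hB
  refine ⟨C + C', add_nonneg hC hC', fun x => ?_⟩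
  rw [LinearMap.add_apply, add_mul]
  exact (PNormedSpace.qnorm_add_rpow_le _ _).trans (add_le_add (h x) (h' x))

theorem IsQBounded.neg {A : X →ₗ[ℝ] Y} (hA : IsQBounded p A) : IsQBounded p (-A) := by
  obtain ⟨C, hC, h⟩ := hA
  refine ⟨C, hC, fun x => ?_⟩
  have : (-A) x = (-1 : ℝ) • A x := by simp
  rw [this, PNormedSpace.qnorm_smul p, abs_neg, abs_one, one_mul]
  exact h x

variable [PNormedSpace p X]

theorem IsQBounded.qnorm_le {A : X →ₗ[ℝ] Y} (hA : IsQBounded p A) :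
    ∃ C : ℝ, ∀ x, QNorm.qnorm (A x) ≤ C * QNorm.qnorm x := by
  obtain ⟨C, hC, h⟩ := hA
  refine ⟨C ^ (1 / (p : ℝ)), fun x => ?_⟩
  have hx := PNormedSpace.qnorm_nonneg p x
  refine (Real.rpow_le_rpow_iff (PNormedSpace.qnorm_nonneg p _) (by positivity) p.2.1).1 ?_
  rw [Real.mul_rpow (by positivity) hx, ← Real.rpow_mul hC, one_div_mul_cancel p.2.1.ne',
    Real.rpow_one]
  exact h x

/-- A bounded linear map acts coordinatewise on the `ℓ_p`-sum. -/
def LpSum.map (A : X →ₗ[ℝ] X) (hA : IsQBounded p A) : LpSum p X →ₗ[ℝ] LpSum p X where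
  toFun w := ⟨fun n => A ((w : ℕ → X) n), by
    obtain ⟨C, -, h⟩ := hA
    exact Summable.of_nonneg_of_le (fun n => Real.rpow_nonneg (PNormedSpace.qnorm_nonneg p _) _)
      (fun n => h _) (w.2.mul_left C)⟩
  map_add' w w' := by ext1; funext n; exact map_add A _ _
  map_smul' a w := by ext1; funext n; exact map_smul A _ _

theorem LpSum.isQBounded_map (A : X →ₗ[ℝ] X) (hA : IsQBounded p A) :
    IsQBounded p (LpSum.map A hA) := by
  obtain ⟨C, hC, h⟩ := id hA
  refine ⟨C, hC, fun w => ?_⟩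
  rw [LpSum.qnorm_rpow, LpSum.qnorm_rpow, ← tsum_mul_left]
  exact Summable.tsum_le_tsum (fun n => h _) (LpSum.map A hA w).2 (w.2.mul_left C)

variable (p X)

/-- The sequence `x, w 0, w 1, …`. -/
def consSeq (x : X) (w : ℕ → X) : ℕ → X := fun n => Nat.casesOn n x w

/-- Prepending an element to a sequence in the `ℓ_p`-sum. -/
def LpSum.cons : X × LpSum p X →ₗ[ℝ] LpSum p X where
  toFun z := ⟨consSeq X z.1 z.2, (summable_nat_add_iff 1).1 z.2.2⟩
  map_add' w w' := by ext1; funext n; cases n <;> rfl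
  map_smul' a w := by ext1; funext n; cases n <;> rfl

theorem LpSum.qnorm_cons_rpow (z : X × LpSum p X) :
    QNorm.qnorm (LpSum.cons p X z) ^ (p : ℝ) =
      QNorm.qnorm z.1 ^ (p : ℝ) + QNorm.qnorm z.2 ^ (p : ℝ) := by
  rw [LpSum.qnorm_rpow, LpSum.qnorm_rpow, Summable.tsum_eq_zero_add (LpSum.cons p X z).2]
  rfl

theorem LpSum.isQBounded_cons_inl :
    IsQBounded p (LpSum.cons p X ∘ₗ LinearMap.inl ℝ X (LpSum p X)) :=
  ⟨1, zero_le_one, fun x => by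
    rw [LinearMap.comp_apply, LpSum.qnorm_cons_rpow]
    simp [PNormedSpace.qnorm_zero p, Real.zero_rpow p.2.1.ne']⟩

theorem LpSum.isQBounded_cons_inr :
    IsQBounded p (LpSum.cons p X ∘ₗ LinearMap.inr ℝ X (LpSum p X)) :=
  ⟨1, zero_le_one, fun x => by
    rw [LinearMap.comp_apply, LpSum.qnorm_cons_rpow]
    simp [PNormedSpace.qnorm_zero p, Real.zero_rpow p.2.1.ne']⟩

/-- The first term of a sequence in the `ℓ_p`-sum. -/
def LpSum.head : LpSum p X →ₗ[ℝ] X where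
  toFun w := (w : ℕ → X) 0
  map_add' _ _ := rfl
  map_smul' _ _ := rfl

/-- Removing the first term of a sequence in the `ℓ_p`-sum. -/
def LpSum.tail : LpSum p X →ₗ[ℝ] LpSum p X where
  toFun w := ⟨fun n => (w : ℕ → X) (n + 1), (summable_nat_add_iff 1).2 w.2⟩
  map_add' _ _ := rfl
  map_smul' _ _ := rfl

theorem LpSum.qnorm_head_add_tail (w : LpSum p X) :
    QNorm.qnorm w ^ (p : ℝ) = QNorm.qnorm (LpSum.head p X w) ^ (p : ℝ) +
      QNorm.qnorm (LpSum.tail p X w) ^ (p : ℝ) := by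
  rw [LpSum.qnorm_rpow, LpSum.qnorm_rpow, Summable.tsum_eq_zero_add w.2]
  rfl

theorem LpSum.isQBounded_head : IsQBounded p (LpSum.head p X) :=
  ⟨1, zero_le_one, fun w => by
    have := Real.rpow_nonneg (PNormedSpace.qnorm_nonneg p (LpSum.tail p X w)) (p : ℝ)
    rw [LpSum.qnorm_head_add_tail]
    linarith⟩

theorem LpSum.isQBounded_tail : IsQBounded p (LpSum.tail p X) :=
  ⟨1, zero_le_one, fun w => by
    have := Real.rpow_nonneg (PNormedSpace.qnorm_nonneg p (LpSum.head p X w)) (p : ℝ)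
    rw [LpSum.qnorm_head_add_tail p X w]
    linarith⟩

variable {p X}

/-- Pełczyński's decomposition method: if `ℓ_p(X)` is complemented in `X`, then `X ≃ ℓ_p(X)`. -/
theorem qisomorphic_lpSum_of_complemented (S : LpSum p X →ₗ[ℝ] X) (T : X →ₗ[ℝ] LpSum p X)
    (hTS : ∀ w, T (S w) = w) (hS : IsQBounded p S) (hT : IsQBounded p T) :
    QIsomorphic X (LpSum p X) := by
  set P : X →ₗ[ℝ] X := S ∘ₗ T with hP
  have hPb : IsQBounded p P := hS.comp hT
  set Q : X →ₗ[ℝ] X := LinearMap.id + -P with hQ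
  have hQb : IsQBounded p Q := isQBounded_id.add hPb.neg
  have hPP : ∀ x, P (P x) = P x := fun x => by simp [hP, hTS]
  have hQP : ∀ x, Q (P x) = 0 := fun x => by simp [hQ, hPP]
  have hPQ : ∀ x, P (Q x) = 0 := fun x => by simp [hQ, hPP]
  have hQQ : ∀ x, Q (Q x) = Q x := fun x => by
    change Q x + -P (Q x) = Q x
    simp [hPQ]
  have hQS : ∀ w, Q (S w) = 0 := fun w => by simp [hQ, hP, hTS]
  have hTQ : ∀ x, T (Q x) = 0 := fun x => by simp [hQ, hP, hTS]
  have hPaddQ : ∀ x, P x + Q x = x := fun x => by simp [hQ]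
  -- `Φ x` has the P-components of `T x` in place, while its Q-components are shifted up by one so
  -- that `Q x` fits into slot 0. `W` undoes the shift and recovers `T x`; `S` then gives `P x`, and
  -- slot 0 gives `Q x`.
  let Φ : X →ₗ[ℝ] LpSum p X := LpSum.map P hPb ∘ₗ T +
    ((LpSum.cons p X ∘ₗ LinearMap.inr ℝ X (LpSum p X)) ∘ₗ LpSum.map Q hQb ∘ₗ T +
      (LpSum.cons p X ∘ₗ LinearMap.inl ℝ X (LpSum p X)) ∘ₗ Q)
  let W : LpSum p X →ₗ[ℝ] LpSum p X := LpSum.map P hPb + LpSum.map Q hQb ∘ₗ LpSum.tail p X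
  let Ψ : LpSum p X →ₗ[ℝ] X := S ∘ₗ W + Q ∘ₗ LpSum.head p X
  have hΦ0 : ∀ x, (Φ x : ℕ → X) 0 = P ((T x : ℕ → X) 0) + Q x := fun x => by
    change P ((T x : ℕ → X) 0) + (0 + Q x) = _
    rw [zero_add]
  have hΦs : ∀ x n, (Φ x : ℕ → X) (n + 1) =
      P ((T x : ℕ → X) (n + 1)) + Q ((T x : ℕ → X) n) := fun x n => by
    change P ((T x : ℕ → X) (n + 1)) + (Q ((T x : ℕ → X) n) + 0) = _
    rw [add_zero]
  have hW : ∀ z n, (W z : ℕ → X) n = P ((z : ℕ → X) n) + Q ((z : ℕ → X) (n + 1)) :=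
    fun _ _ => rfl
  have hΨ : ∀ z, Ψ z = S (W z) + Q ((z : ℕ → X) 0) := fun _ => rfl
  refine ⟨Φ, Ψ, ?_, ?_, IsQBounded.qnorm_le (p := p) ?_, IsQBounded.qnorm_le (p := p) ?_⟩
  · ext x
    have hWx : W (Φ x) = T x := by
      ext1; funext n
      rw [hW, hΦs, map_add, hQP, hQQ, zero_add]
      cases n with
      | zero => simp [hΦ0, hPP, hPQ, hPaddQ]
      | succ n => simp [hΦs, hPP, hPQ, hPaddQ]
    change Ψ (Φ x) = x
    rw [hΨ, hWx, hΦ0, map_add, hQP, hQQ, zero_add]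
    exact hPaddQ x
  · refine LinearMap.ext fun z => ?_
    have hTz : T (Ψ z) = W z := by rw [hΨ, map_add, hTS, hTQ, add_zero]
    have hQz : Q (Ψ z) = Q ((z : ℕ → X) 0) := by rw [hΨ, map_add, hQS, hQQ, zero_add]
    change Φ (Ψ z) = z
    ext1; funext n
    cases n with
    | zero => rw [hΦ0, hTz, hQz, hW, map_add, hPP, hPQ, add_zero, hPaddQ]
    | succ n =>
      rw [hΦs, hTz, hW, hW, map_add, map_add, hPP, hPQ, hQP, hQQ, add_zero, zero_add, hPaddQ]
  · exact ((LpSum.isQBounded_map P hPb).comp hT).add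
      (((LpSum.isQBounded_cons_inr p X).comp ((LpSum.isQBounded_map Q hQb).comp hT)).add
        ((LpSum.isQBounded_cons_inl p X).comp hQb))
  · exact (hS.comp ((LpSum.isQBounded_map P hPb).add
      ((LpSum.isQBounded_map Q hQb).comp (LpSum.isQBounded_tail p X)))).add
        (hQb.comp (LpSum.isQBounded_head p X))

end

end Decomposition

/-! ### Doubling spaces: counting separated points and extending δ from a net. -/

section Net

variable {M : Type*} [MetricSpace M]

theorem IsDoublingSpace.exists_cover (hM : IsDoublingSpace M) :
    ∃ D : ℕ, ∀ (k : ℕ) (x : M) (r : ℝ), 0 < r → ∃ s : Finset M, s.card ≤ D ^ k ∧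
      Metric.closedBall x r ⊆ ⋃ y ∈ s, Metric.closedBall y (r / 2 ^ k) := by
  classical
  obtain ⟨D, hD⟩ := hM
  refine ⟨D, fun k => ?_⟩
  induction k with
  | zero => exact fun x r _ => ⟨{x}, by simp⟩
  | succ k ih =>
    intro x r hr
    obtain ⟨s, hs, hsub⟩ := ih x r hr
    choose t ht htsub using fun y => hD y (r / 2 ^ k) (by positivity)
    refine ⟨s.biUnion t, ?_, fun z hz => ?_⟩
    · refine (Finset.card_biUnion_le_card_mul s t D fun y _ => ht y).trans ?_
      rw [pow_succ]
      exact Nat.mul_le_mul_right D hs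
    · obtain ⟨y, hy, hzy⟩ := Set.mem_iUnion₂.1 (hsub hz)
      obtain ⟨y', hy', hzy'⟩ := Set.mem_iUnion₂.1 (htsub y hzy)
      refine Set.mem_iUnion₂.2 ⟨y', Finset.mem_biUnion.2 ⟨y, hy, hy'⟩, ?_⟩
      rwa [pow_succ, ← div_div]

/-- In a doubling space, the number of points of a separated set in a ball is bounded in terms of
the radius of the ball. -/
theorem IsDoublingSpace.exists_card_le (hM : IsDoublingSpace M) {N : Type*} (i : N → M) {a : ℝ}
    (ha : 0 < a) (hsep : ∀ x y, x ≠ y → a ≤ dist (i x) (i y)) {r : ℝ} (hr : 0 < r) :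
    ∃ B : ℕ, ∀ (z : M) (F : Finset N), (∀ x ∈ F, dist z (i x) ≤ r) → F.card ≤ B := by
  obtain ⟨D, hD⟩ := hM.exists_cover
  -- With this `k`, balls of radius r / 2^k have diameter less than `a`, so each contains at most
  -- one of the separated points.
  obtain ⟨k, hk⟩ := pow_unbounded_of_one_lt (2 * r / a) (one_lt_two (α := ℝ))
  refine ⟨D ^ k, fun z F hF => ?_⟩
  obtain ⟨s, hs, hsub⟩ := hD k z r hr
  have hex : ∀ x ∈ F, ∃ y ∈ s, dist (i x) y ≤ r / 2 ^ k := fun x hx => by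
    have hx' : i x ∈ Metric.closedBall z r := by
      rw [Metric.mem_closedBall, dist_comm]; exact hF x hx
    obtain ⟨y, hy, hxy⟩ := Set.mem_iUnion₂.1 (hsub hx')
    exact ⟨y, hy, hxy⟩
  have : Nonempty M := ⟨z⟩
  choose! c hc hcd using hex
  refine (Finset.card_le_card_of_injOn c hc fun x hx y hy hxy => ?_).trans hs
  by_contra hne
  have h1 := hcd x hx
  have h2 := hcd y hy
  have h2' : dist (c x) (i y) ≤ r / 2 ^ k := by rw [hxy, dist_comm]; exact h2
  have h3 := dist_triangle (i x) (c x) (i y)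
  have h4 := hsep x y hne
  have h5 : 2 * (r / 2 ^ k) < a := by
    rw [div_lt_iff₀ ha] at hk
    rw [← mul_div_assoc, div_lt_iff₀ (by positivity)]
    linarith
  linarith

/-- Quotient rule for normalized weights: w'/W' ≤ 1 keeps the variation of the denominator from
being amplified beyond 1/τ. -/
theorem abs_div_sub_div_le {w w' W W' τ : ℝ} (hτ : 0 < τ) (hW : τ ≤ W) (hW' : τ ≤ W')
    (hw' : 0 ≤ w') (hwW' : w' ≤ W') : |w / W - w' / W'| ≤ (|w - w'| + |W - W'|) / τ := by
  have hW0 := hτ.trans_le hW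
  have hW0' := hτ.trans_le hW'
  have h : w / W - w' / W' = ((w - w') + w' / W' * (W' - W)) / W := by
    field_simp
    ring
  rw [h, abs_div, abs_of_pos hW0]
  refine div_le_div₀ (by positivity) ?_ hτ hW
  refine (abs_add_le _ _).trans (add_le_add le_rfl ?_)
  rw [abs_mul, abs_of_nonneg (by positivity), abs_sub_comm]
  exact mul_le_of_le_one_left (abs_nonneg _) ((div_le_one hW0').2 hwW')

/-- If `N` is a net in a doubling space `M`, then the canonical embedding of `N` into its Lipschitz
free `p`-space has a Lipschitz extension to `M` which is constant near each point of `N`. -/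
theorem IsDoublingSpace.exists_extend_freeDelta (hM : IsDoublingSpace M)
    (p : Set.Ioc (0 : ℝ) 1) {N : Type u} [MetricSpace N] (e : N) (i : N → M)
    {a b K : ℝ} (ha : 0 < a) (hb : 0 < b) (hK : 0 < K)
    (hsep : ∀ x y, x ≠ y → a ≤ dist (i x) (i y)) (hdense : ∀ z, ∃ x, dist z (i x) ≤ b)
    (hi : ∀ x y, dist x y ≤ K * dist (i x) (i y)) :
    ∃ (r : M → FreePSpace p e) (C : ℝ), 0 < C ∧
      (∀ z z', ‖r z - r z'‖ ≤ C * dist z z' ^ (p : ℝ)) ∧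
      ∀ z x, dist z (i x) ≤ a / 8 → r z = freeDelta p e x := by
  classical
  have hp := p.2.1
  obtain ⟨B, hB⟩ := hM.exists_card_le i ha hsep (r := b + a / 2) (by positivity)
  have hfin : ∀ z, {x | dist z (i x) ≤ b + a / 2}.Finite := fun z => by
    by_contra hinf
    obtain ⟨F, hF, hcard⟩ := Set.Infinite.exists_subset_card_eq hinf (B + 1)
    have := hB z F fun x hx => hF hx
    omega
  have hne : (Set.range i).Nonempty := ⟨i e, e, rfl⟩
  let A : M → Finset N := fun z => (hfin z).toFinset
  have hA : ∀ z x, x ∈ A z ↔ dist z (i x) ≤ b + a / 2 := fun z x => by simp [A]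
  have hAcard : ∀ z, (A z).card ≤ B := fun z => hB z _ fun x hx => (hA z x).1 hx
  let D : M → ℝ := fun z => Metric.infDist z (Set.range i)
  have hDle : ∀ z x, D z ≤ dist z (i x) := fun z x => Metric.infDist_le_dist_of_mem ⟨x, rfl⟩
  have hDb : ∀ z, D z ≤ b := fun z => by
    obtain ⟨x, hx⟩ := hdense z
    exact (hDle z x).trans hx
  -- Comparing with the distance `D z` to the net serves two purposes: an almost nearest net point
  -- always has weight at least a/4, and if `z` is within a/8 of a net point, any other one is at
  -- distance at least 7a/8 > D z + a/2 and has weight zero.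
  let w : N → M → ℝ := fun x z => max 0 (D z + a / 2 - dist z (i x))
  have hw0 : ∀ x z, 0 ≤ w x z := fun x z => le_max_left _ _
  have hwA : ∀ x z, x ∉ A z → w x z = 0 := fun x z hx => by
    rw [hA, not_le] at hx
    exact max_eq_left (by linarith [hDb z])
  have hwlip : ∀ x z z', |w x z - w x z'| ≤ 2 * dist z z' := fun x z z' => by
    have h1 : |D z - D z'| ≤ dist z z' := by
      have := (Metric.lipschitz_infDist_pt (Set.range i)).dist_le_mul z z'
      simpa [Real.dist_eq] using this
    have h2 : |dist z (i x) - dist z' (i x)| ≤ dist z z' := abs_dist_sub_le z z' (i x)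
    have h := abs_max_sub_max_le_max 0 (D z + a / 2 - dist z (i x)) 0
      (D z' + a / 2 - dist z' (i x))
    refine h.trans (max_le (by simp) ?_)
    have h3 : D z + a / 2 - dist z (i x) - (D z' + a / 2 - dist z' (i x)) =
        (D z - D z') - (dist z (i x) - dist z' (i x)) := by ring
    rw [h3]
    linarith [abs_sub (D z - D z') (dist z (i x) - dist z' (i x))]
  let W : M → ℝ := fun z => ∑ x ∈ A z, w x z
  have hWU : ∀ z (U : Finset N), A z ⊆ U → ∑ x ∈ U, w x z = W z := fun z U hU =>
    (Finset.sum_subset hU fun x _ hx => hwA x z hx).symm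
  have hW : ∀ z, a / 4 ≤ W z := fun z => by
    obtain ⟨_, ⟨x, rfl⟩, hx⟩ := (Metric.infDist_lt_iff hne).1
      (show Metric.infDist z (Set.range i) < D z + a / 4 from lt_add_of_pos_right _ (by positivity))
    have h1 : a / 4 ≤ w x z := le_max_of_le_right (by linarith)
    have hxA : x ∈ A z := by
      by_contra h
      rw [hwA x z h] at h1
      linarith
    exact h1.trans (Finset.single_le_sum (f := fun x => w x z) (fun x _ => hw0 x z) hxA)
  have hWpos : ∀ z, 0 < W z := fun z => lt_of_lt_of_le (by positivity) (hW z)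
  have hwW : ∀ x z, w x z ≤ W z := fun x z => by
    by_cases hx : x ∈ A z
    · exact Finset.single_le_sum (f := fun x => w x z) (fun x _ => hw0 x z) hx
    · rw [hwA x z hx]
      exact (hWpos z).le
  let c : N → M → ℝ := fun x z => w x z / W z
  have hc0 : ∀ x z, 0 ≤ c x z := fun x z => div_nonneg (hw0 x z) (hWpos z).le
  have hc1 : ∀ x z, c x z ≤ 1 := fun x z => (div_le_one (hWpos z)).2 (hwW x z)
  have hcA : ∀ x z, x ∉ A z → c x z = 0 := fun x z hx => by simp [c, hwA x z hx]
  have hcsum : ∀ z (U : Finset N), A z ⊆ U → ∑ x ∈ U, c x z = 1 := fun z U hU => by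
    simp only [c]
    rw [← Finset.sum_div, hWU z U hU, div_self (hWpos z).ne']
  let r : M → FreePSpace p e := fun z => ∑ x ∈ A z, c x z • freeDelta p e x
  have hrU : ∀ z (U : Finset N), A z ⊆ U → ∑ x ∈ U, c x z • freeDelta p e x = r z := fun z U hU =>
    (Finset.sum_subset hU fun x _ hx => by rw [hcA x z hx, zero_smul]).symm
  set C₁ : ℝ := (2 + 2 * B * 2) / (a / 4) with hC₁
  set C₂ : ℝ := C₁ * (2 * b + a / 2) + 1 with hC₂
  have hC₁0 : 0 ≤ C₁ := by positivity
  have hC₂0 : 0 < C₂ := by positivity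
  refine ⟨r, 2 * B * (K * C₂) ^ (p : ℝ) + 1, by positivity, fun z z' => ?_, fun z x₀ hx₀ => ?_⟩
  · set t := dist z z' with ht
    have ht0 : 0 ≤ t := dist_nonneg
    set U := A z ∪ A z' with hU
    have hUcard : (U.card : ℝ) ≤ 2 * B := by
      have := (Finset.card_union_le (A z) (A z')).trans (add_le_add (hAcard z) (hAcard z'))
      calc (U.card : ℝ) ≤ ((B + B : ℕ) : ℝ) := by exact_mod_cast this
        _ = 2 * B := by push_cast; ring
    have hzU : A z ⊆ U := Finset.subset_union_left
    have hzU' : A z' ⊆ U := Finset.subset_union_right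
    have hWlip : |W z - W z'| ≤ 2 * B * (2 * t) := by
      rw [← hWU z U hzU, ← hWU z' U hzU', ← Finset.sum_sub_distrib]
      refine (Finset.abs_sum_le_sum_abs _ _).trans ?_
      refine (Finset.sum_le_card_nsmul U _ (2 * t) fun x _ => hwlip x z z').trans ?_
      rw [nsmul_eq_mul]
      gcongr
    have hclip : ∀ x, |c x z - c x z'| ≤ C₁ * t := fun x => by
      refine (abs_div_sub_div_le (by positivity : 0 < a / 4) (hW z) (hW z') (hw0 x z')
        (hwW x z')).trans ?_
      rw [hC₁, div_mul_eq_mul_div]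
      gcongr
      linarith [hwlip x z z']
    obtain ⟨x₀, hx₀⟩ := hdense z
    -- The coefficients sum to 1 at both points, so a common δ(x₀) may be subtracted from every
    -- term.
    have hdiff : r z - r z' =
        ∑ x ∈ U, (c x z - c x z') • (freeDelta p e x - freeDelta p e x₀) := by
      simp only [smul_sub, Finset.sum_sub_distrib, ← Finset.sum_smul]
      rw [hcsum z U hzU, hcsum z' U hzU', sub_self, zero_smul, sub_zero]
      simp only [sub_smul, Finset.sum_sub_distrib]
      rw [hrU z U hzU, hrU z' U hzU']
    have hterm : ∀ x ∈ U, ‖(c x z - c x z') • (freeDelta p e x - freeDelta p e x₀)‖ ≤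
        (K * C₂ * t) ^ (p : ℝ) := fun x hx => by
      have hdist : dist (i x) (i x₀) ≤ 2 * b + a / 2 + t := by
        have h1 := dist_triangle_left (i x) (i x₀) z
        rcases Finset.mem_union.1 hx with h | h
        · linarith [(hA z x).1 h]
        · linarith [(hA z' x).1 h, dist_triangle z z' (i x)]
      rw [FreePSpace.norm_smul]
      refine (mul_le_mul_of_nonneg_left (norm_freeDelta_sub_le p e x x₀) (by positivity)).trans ?_
      rw [← Real.mul_rpow (abs_nonneg _) dist_nonneg]
      refine Real.rpow_le_rpow (by positivity) ?_ hp.le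
      -- The distance from `x` to `x₀` is bounded by a constant plus `t`. The constant part is
      -- paired with the bound C₁ t on the coefficient, the part `t` with this trivial bound, so the
      -- product is linear in `t` for small and large `t` alike.
      have habs1 : |c x z - c x z'| ≤ 1 :=
        abs_sub_le_of_nonneg_of_le (hc0 x z) (hc1 x z) (hc0 x z') (hc1 x z')
      calc |c x z - c x z'| * dist x x₀
          ≤ |c x z - c x z'| * (K * (2 * b + a / 2 + t)) := by
            gcongr
            exact (hi x x₀).trans (by gcongr)
        _ = K * (|c x z - c x z'| * (2 * b + a / 2) + |c x z - c x z'| * t) := by ring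
        _ ≤ K * (C₁ * t * (2 * b + a / 2) + 1 * t) := by
            gcongr
            exact hclip x
        _ = K * C₂ * t := by rw [hC₂]; ring
    rw [hdiff]
    refine (norm_sum_le_of_le U hterm).trans ?_
    rw [Finset.sum_const, nsmul_eq_mul, Real.mul_rpow (by positivity) ht0, ← mul_assoc]
    gcongr
    refine (mul_le_mul_of_nonneg_right hUcard (by positivity)).trans ?_
    linarith
  · have hother : ∀ x, x ≠ x₀ → c x z = 0 := fun x hx => by
      have h1 := hsep x x₀ hx
      have h2 := dist_triangle_left (i x) (i x₀) z
      have h3 := hDle z x₀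
      have : w x z = 0 := max_eq_left (by linarith)
      simp [c, this]
    have hmem : x₀ ∈ A z := (hA z x₀).2 (by linarith)
    have h1 := hcsum z (A z) subset_rfl
    rw [Finset.sum_eq_single_of_mem x₀ hmem fun x _ hx => hother x hx] at h1
    change ∑ x ∈ A z, c x z • freeDelta p e x = _
    rw [Finset.sum_eq_single_of_mem x₀ hmem fun x _ hx => by rw [hother x hx, zero_smul], h1,
      one_smul]

end Net

/-! ### From biorthogonal operators to a complemented ℓ_p-sum. -/

section Complemented

variable {p : Set.Ioc (0 : ℝ) 1} {N : Type u} [MetricSpace N] {e : N}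

/-- Operators `S n` and `T n` with `T m ∘ S n = δ_{mn}`, the former uniformly bounded and the
latter jointly bounded, realize `ℓ_p(X)` as a complemented subspace of `X`. -/
theorem FreePSpace.qisomorphic_lpSum (S T : ℕ → FreePSpace p e →L[ℝ] FreePSpace p e) {C C' : ℝ}
    (hC : 0 ≤ C) (hC' : 0 ≤ C') (hS : ∀ n v, ‖S n v‖ ≤ C * ‖v‖)
    (hT : ∀ (F : Finset ℕ) v, ∑ n ∈ F, ‖T n v‖ ≤ C' * ‖v‖)
    (hTS : ∀ n v, T n (S n v) = v) (hTS' : ∀ m n v, m ≠ n → T m (S n v) = 0) :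
    QIsomorphic (FreePSpace p e) (LpSum p (FreePSpace p e)) := by
  have hnorm : ∀ w : LpSum p (FreePSpace p e), Summable fun n => ‖(w : ℕ → FreePSpace p e) n‖ :=
    fun w => by
      have := w.2
      simpa only [FreePSpace.qnorm_rpow] using (show Summable _ from this)
  have hbd : ∀ (w : LpSum p (FreePSpace p e)) n,
      ‖S n ((w : ℕ → FreePSpace p e) n)‖ ≤ C * ‖(w : ℕ → FreePSpace p e) n‖ := fun w n => hS n _
  have hsum : ∀ w : LpSum p (FreePSpace p e),
      Summable fun n => S n ((w : ℕ → FreePSpace p e) n) := fun w =>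
    Summable.of_norm_bounded ((hnorm w).mul_left C) (hbd w)
  let S' : LpSum p (FreePSpace p e) →ₗ[ℝ] FreePSpace p e :=
    { toFun := fun w => ∑' n, S n ((w : ℕ → FreePSpace p e) n)
      map_add' := fun w w' => by
        rw [← Summable.tsum_add (hsum w) (hsum w')]
        exact tsum_congr fun n => map_add (S n) _ _
      map_smul' := fun a w => by
        rw [RingHom.id_apply, ← Summable.tsum_const_smul a (hsum w)]
        exact tsum_congr fun n => map_smul (S n) _ _ }
  have hTsum : ∀ v, Summable fun n => ‖T n v‖ := fun v =>
    summable_of_sum_le (fun n => norm_nonneg _) fun F => hT F v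
  let T' : FreePSpace p e →ₗ[ℝ] LpSum p (FreePSpace p e) :=
    { toFun := fun v => ⟨fun n => T n v, by
        change Summable _
        simpa only [FreePSpace.qnorm_rpow] using hTsum v⟩
      map_add' := fun v v' => by ext1; funext n; exact map_add (T n) _ _
      map_smul' := fun a v => by ext1; funext n; exact map_smul (T n) _ _ }
  refine qisomorphic_lpSum_of_complemented S' T' (fun w => ?_) ⟨C, hC, fun w => ?_⟩
    ⟨C', hC', fun v => ?_⟩
  · ext1; funext m
    change T m (∑' n, S n ((w : ℕ → FreePSpace p e) n)) = _
    rw [(T m).map_tsum (hsum w), tsum_eq_single m fun n hn => hTS' m n _ hn.symm, hTS]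
  · rw [FreePSpace.qnorm_rpow, LpSum.qnorm_rpow]
    simp only [FreePSpace.qnorm_rpow]
    rw [← tsum_mul_left]
    exact tsum_of_norm_bounded ((hnorm w).mul_left C).hasSum (hbd w)
  · rw [FreePSpace.qnorm_rpow, LpSum.qnorm_rpow]
    simp only [FreePSpace.qnorm_rpow]
    exact Real.tsum_le_of_sum_le (fun n => norm_nonneg _) fun F => hT F v

end Complemented

/-! ### Radial cutoff functions and partitions of unity. -/

section Cutoff

/-- The piecewise linear function which is `1` on `(-∞, v]` and `0` on `[2 v, ∞)`. -/
def linearCutoff (v t : ℝ) : ℝ := max 0 (min 1 (2 - t / v))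

theorem linearCutoff_nonneg (v t : ℝ) : 0 ≤ linearCutoff v t := le_max_left _ _

theorem linearCutoff_le_one (v t : ℝ) : linearCutoff v t ≤ 1 :=
  max_le zero_le_one (min_le_left _ _)

theorem linearCutoff_eq_one {v t : ℝ} (hv : 0 < v) (h : t ≤ v) : linearCutoff v t = 1 := by
  have : t / v ≤ 1 := (div_le_one hv).2 h
  rw [linearCutoff, min_eq_left (by linarith), max_eq_right zero_le_one]

theorem linearCutoff_eq_zero {v t : ℝ} (hv : 0 < v) (h : 2 * v ≤ t) : linearCutoff v t = 0 := by
  have : 2 ≤ t / v := (le_div_iff₀ hv).2 h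
  rw [linearCutoff, max_eq_left ((min_le_right _ _).trans (by linarith))]

theorem abs_linearCutoff_sub_le {v : ℝ} (hv : 0 < v) (s t : ℝ) :
    |linearCutoff v s - linearCutoff v t| ≤ |s - t| / v := by
  have h1 := abs_max_sub_max_le_max 0 (min 1 (2 - s / v)) 0 (min 1 (2 - t / v))
  have h2 := abs_min_sub_min_le_max 1 (2 - s / v) 1 (2 - t / v)
  have h3 : 2 - s / v - (2 - t / v) = -((s - t) / v) := by ring
  rw [h3, abs_neg, abs_div, abs_of_pos hv] at h2
  have h4 : 0 ≤ |s - t| / v := by positivity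
  refine h1.trans (max_le (by simpa using h4) (h2.trans (max_le (by simpa using h4) le_rfl)))

variable {p : Set.Ioc (0 : ℝ) 1} {N : Type u} [MetricSpace N] {e : N}

/-- Product rule. The cutoff has slope at most 1/v and varies only below 2v, where the vector itself
has size at most L (2v)^p; so varying the cutoff costs 2 and varying the vector costs 1,
independently of v. -/
theorem norm_linearCutoff_smul_sub_le {v L s t d : ℝ} (hv : 0 < v) (hL : 0 ≤ L) (hs : 0 ≤ s)
    (ht : 0 ≤ t) (hst : |s - t| ≤ d) {x y : FreePSpace p e} (hx : ‖x‖ ≤ L * s ^ (p : ℝ))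
    (hy : ‖y‖ ≤ L * t ^ (p : ℝ)) (hxy : ‖x - y‖ ≤ L * d ^ (p : ℝ)) :
    ‖linearCutoff v s • x - linearCutoff v t • y‖ ≤ 3 * L * d ^ (p : ℝ) := by
  -- The difference of cutoffs will multiply the vector at the smaller radius: if s ≥ 2v, both
  -- cutoffs vanish.
  wlog hle : s ≤ t generalizing s t x y
  · rw [norm_sub_rev]
    exact this ht hs (by rwa [abs_sub_comm]) hy hx (by rwa [norm_sub_rev]) (le_of_not_ge hle)
  have hp := p.2.1
  have hd : 0 ≤ d := (abs_nonneg _).trans hst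
  have hdec : linearCutoff v s • x - linearCutoff v t • y =
      (linearCutoff v s - linearCutoff v t) • x + linearCutoff v t • (x - y) := by
    rw [sub_smul, smul_sub]; abel
  have h1 : |linearCutoff v s - linearCutoff v t| * s ≤ 2 * d := by
    rcases le_total (2 * v) s with h | h
    · rw [linearCutoff_eq_zero hv h, linearCutoff_eq_zero hv (h.trans hle)]
      simpa using hd
    · calc _ ≤ |s - t| / v * (2 * v) := by
            gcongr
            exact abs_linearCutoff_sub_le hv s t
        _ = 2 * |s - t| := by field_simp
        _ ≤ 2 * d := by gcongr
  have h2 : ‖(linearCutoff v s - linearCutoff v t) • x‖ ≤ L * (2 * d ^ (p : ℝ)) := by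
    rw [FreePSpace.norm_smul]
    calc _ ≤ |linearCutoff v s - linearCutoff v t| ^ (p : ℝ) * (L * s ^ (p : ℝ)) := by gcongr
      _ = L * (|linearCutoff v s - linearCutoff v t| * s) ^ (p : ℝ) := by
          rw [Real.mul_rpow (abs_nonneg _) hs]; ring
      _ ≤ L * (2 * d) ^ (p : ℝ) := by gcongr
      _ = L * (2 ^ (p : ℝ) * d ^ (p : ℝ)) := by rw [Real.mul_rpow zero_le_two hd]
      _ ≤ L * (2 * d ^ (p : ℝ)) := by
          gcongr
          exact Real.rpow_le_self_of_one_le one_le_two p.2.2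
  have h3 : ‖linearCutoff v t • (x - y)‖ ≤ L * d ^ (p : ℝ) := by
    rw [FreePSpace.norm_smul, abs_of_nonneg (linearCutoff_nonneg v t)]
    refine (mul_le_of_le_one_left (norm_nonneg _) ?_).trans hxy
    exact Real.rpow_le_one (linearCutoff_nonneg v t) (linearCutoff_le_one v t) hp.le
  rw [hdec]
  refine (norm_add_le _ _).trans ((add_le_add h2 h3).trans (le_of_eq (by ring)))

variable (p e) in
/-- A function `φ` of the distance to the base point, such that multiplication by `φ` preserves
Lipschitz maps which vanish at the base point, and multiplies their Lipschitz constants by at most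
`A` (in terms of the `p`-th powers of the norms). -/
def IsCutoff (A : ℝ) (φ : ℝ → ℝ) : Prop :=
  ∀ ⦃L s t d : ℝ⦄, 0 ≤ L → 0 ≤ s → 0 ≤ t → |s - t| ≤ d → ∀ ⦃x y : FreePSpace p e⦄,
    ‖x‖ ≤ L * s ^ (p : ℝ) → ‖y‖ ≤ L * t ^ (p : ℝ) → ‖x - y‖ ≤ L * d ^ (p : ℝ) →
    ‖φ s • x - φ t • y‖ ≤ A * L * d ^ (p : ℝ)

theorem isCutoff_linearCutoff {v : ℝ} (hv : 0 < v) : IsCutoff p e 3 (linearCutoff v) :=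
  fun _ _ _ _ hL hs ht hst _ _ hx hy hxy =>
    norm_linearCutoff_smul_sub_le hv hL hs ht hst hx hy hxy

theorem IsCutoff.sub {A B : ℝ} {φ ψ : ℝ → ℝ} (hφ : IsCutoff p e A φ) (hψ : IsCutoff p e B ψ) :
    IsCutoff p e (A + B) fun s => φ s - ψ s := by
  intro L s t d hL hs ht hst x y hx hy hxy
  have h : (φ s - ψ s) • x - (φ t - ψ t) • y =
      (φ s • x - φ t • y) - (ψ s • x - ψ t • y) := by
    rw [sub_smul, sub_smul]; abel
  rw [h]
  refine (norm_sub_le _ _).trans ((add_le_add (hφ hL hs ht hst hx hy hxy)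
    (hψ hL hs ht hst hx hy hxy)).trans (le_of_eq (by ring)))

theorem IsCutoff.mono {A B : ℝ} {φ : ℝ → ℝ} (hφ : IsCutoff p e A φ) (hAB : A ≤ B) :
    IsCutoff p e B φ := by
  intro L s t d hL hs ht hst x y hx hy hxy
  have hd : 0 ≤ d := (abs_nonneg _).trans hst
  exact (hφ hL hs ht hst hx hy hxy).trans (by gcongr)

variable (p e) in
/-- A dyadic partition of unity on the half-line. -/
theorem exists_dyadic_partition {ρ : ℝ} (hρ : 0 < ρ) :
    ∃ (φ : ℕ → ℝ → ℝ) (Z : ℝ → Finset ℕ), (∀ k, IsCutoff p e 6 (φ k)) ∧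
      (∀ s, (Z s).card ≤ 2) ∧ (∀ s, ∀ k ∉ Z s, φ k s = 0) ∧ (∀ s, ∑ k ∈ Z s, φ k s = 1) ∧
      ∀ k s, φ k s ≠ 0 → s ≤ 2 * (2 ^ k * ρ) := by
  classical
  have hpos : ∀ k : ℕ, 0 < 2 ^ k * ρ := fun k => by positivity
  have hex : ∀ s : ℝ, ∃ k : ℕ, s ≤ 2 ^ k * ρ := fun s => by
    obtain ⟨k, hk⟩ := pow_unbounded_of_one_lt (s / ρ) (one_lt_two (α := ℝ))
    exact ⟨k, ((div_lt_iff₀ hρ).1 hk).le⟩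
  -- Successive differences of cutoffs at dyadic scales, so that partial sums telescope to a single
  -- cutoff.
  let φ : ℕ → ℝ → ℝ := fun k => Nat.casesOn k (linearCutoff (2 ^ 0 * ρ)) fun k s =>
    linearCutoff (2 ^ (k + 1) * ρ) s - linearCutoff (2 ^ k * ρ) s
  have hφs : ∀ k s, φ (k + 1) s =
    linearCutoff (2 ^ (k + 1) * ρ) s - linearCutoff (2 ^ k * ρ) s := fun _ _ => rfl
  let κ : ℝ → ℕ := fun s => Nat.find (hex s)
  have hκ : ∀ s, s ≤ 2 ^ κ s * ρ := fun s => Nat.find_spec (hex s)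
  have hκ' : ∀ s k, k < κ s → 2 ^ k * ρ < s := fun s k hk => not_le.1 (Nat.find_min (hex s) hk)
  have hlarge : ∀ k s, 2 * (2 ^ k * ρ) ≤ s → φ k s = 0 := fun k s h => by
    cases k with
    | zero => exact linearCutoff_eq_zero (hpos 0) h
    | succ k =>
      rw [hφs, linearCutoff_eq_zero (hpos _) h, linearCutoff_eq_zero (hpos _), sub_zero]
      have := hpos k
      rw [pow_succ] at h
      linarith
  have hsmall : ∀ k s, κ s < k → φ k s = 0 := fun k s h => by
    cases k with
    | zero => omega
    | succ k =>
      have h1 : s ≤ 2 ^ k * ρ := (hκ s).trans (by gcongr; exacts [one_le_two, by omega])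
      have h2 : s ≤ 2 ^ (k + 1) * ρ := h1.trans (by gcongr; exacts [one_le_two, by omega])
      rw [hφs, linearCutoff_eq_one (hpos _) h1, linearCutoff_eq_one (hpos _) h2, sub_self]
  -- Here `κ s` is the first scale reaching `s`. When it is 0, the truncated subtraction merely
  -- collapses the pair to one index.
  have hsupp : ∀ s, ∀ k ∉ ({κ s - 1, κ s} : Finset ℕ), φ k s = 0 := fun s k hk => by
    simp only [Finset.mem_insert, Finset.mem_singleton, not_or] at hk
    rcases lt_or_ge (κ s) k with h | h
    · exact hsmall k s h
    · refine hlarge k s ?_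
      have := hκ' s (k + 1) (by omega)
      rw [pow_succ] at this
      linarith
  have hsum : ∀ n s, ∑ k ∈ Finset.range (n + 1), φ k s = linearCutoff (2 ^ n * ρ) s := by
    intro n s
    induction n with
    | zero => simp [φ]
    | succ n ih => rw [Finset.sum_range_succ, ih, hφs]; ring
  refine ⟨φ, fun s => {κ s - 1, κ s}, fun k => ?_, fun s => Finset.card_le_two, hsupp, fun s => ?_,
    fun k s hk => ?_⟩
  · cases k with
    | zero => exact (isCutoff_linearCutoff (hpos 0)).mono (by norm_num)
    | succ k =>
      exact ((isCutoff_linearCutoff (hpos (k + 1))).sub (isCutoff_linearCutoff (hpos k))).mono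
        (by norm_num)
  · rw [← linearCutoff_eq_one (hpos (κ s)) (hκ s), ← hsum]
    refine Finset.sum_subset (fun k hk => ?_) fun k _ hk => hsupp s k hk
    simp only [Finset.mem_insert, Finset.mem_singleton] at hk
    exact Finset.mem_range.2 (by omega)
  · by_contra h
    exact hk (hlarge k s (not_le.1 h).le)

variable (p e) in
/-- Cutoff functions for a sparse sequence of intervals `[u j, v j]`, with disjoint supports. -/
theorem exists_sparse_cutoffs {u v : ℕ → ℝ} (hu : ∀ j, 0 < u j) (huv : ∀ j, u j ≤ v j)
    (hsparse : ∀ j, 4 * v j ≤ u (j + 1)) :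
    ∃ (ψ : ℕ → ℝ → ℝ) (J : ℝ → Finset ℕ), (∀ j, IsCutoff p e 6 (ψ j)) ∧
      (∀ s, (J s).card ≤ 1) ∧ (∀ s, ∀ j ∉ J s, ψ j s = 0) ∧
      ∀ j s, u j ≤ s → s ≤ v j → ψ j s = 1 := by
  classical
  have hv : ∀ j, 0 < v j := fun j => (hu j).trans_le (huv j)
  have hu2 : ∀ j, 0 < u j / 2 := fun j => half_pos (hu j)
  have hmono : Monotone u := monotone_nat_of_le_succ fun j => by
    linarith [hsparse j, huv j, hu j]
  -- Supported in (u_j/2, 2v_j); the condition 4v_j ≤ u_{j+1} says exactly that consecutive supports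
  -- are disjoint.
  let ψ : ℕ → ℝ → ℝ := fun j s => linearCutoff (v j) s - linearCutoff (u j / 2) s
  have hψ : ∀ j s, ψ j s ≠ 0 → u j / 2 < s ∧ s < 2 * v j := fun j s h => by
    constructor
    · by_contra hs
      rw [not_lt] at hs
      refine h ?_
      change linearCutoff (v j) s - linearCutoff (u j / 2) s = 0
      rw [linearCutoff_eq_one (hu2 j) hs,
        linearCutoff_eq_one (hv j) (by linarith [hu j, huv j]), sub_self]
    · by_contra hs
      rw [not_lt] at hs
      refine h ?_
      change linearCutoff (v j) s - linearCutoff (u j / 2) s = 0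
      rw [linearCutoff_eq_zero (hu2 j) (by linarith [hu j, huv j]),
        linearCutoff_eq_zero (hv j) hs, sub_self]
  have hlt : ∀ s j j', ψ j s ≠ 0 → ψ j' s ≠ 0 → ¬ j < j' := fun s j j' hj hj' hjj' => by
    have h1 := hmono (Nat.succ_le_of_lt hjj')
    have h2 := (hψ j s hj).2
    have h3 := (hψ j' s hj').1
    have h4 := hsparse j
    rw [Nat.succ_eq_add_one] at h1
    linarith
  refine ⟨ψ, fun s => if h : ∃ j, ψ j s ≠ 0 then {h.choose} else ∅, fun j => ?_, fun s => ?_,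
    fun s j hj => ?_, fun j s h1 h2 => ?_⟩
  · exact ((isCutoff_linearCutoff (hv j)).sub (isCutoff_linearCutoff (hu2 j))).mono (by norm_num)
  · dsimp only
    split_ifs <;> simp
  · by_contra hne
    have hex : ∃ j, ψ j s ≠ 0 := ⟨j, hne⟩
    simp only [dif_pos hex, Finset.mem_singleton] at hj
    rcases lt_or_gt_of_ne hj with h | h
    · exact hlt s _ _ hne hex.choose_spec h
    · exact hlt s _ _ hex.choose_spec hne h
  · change linearCutoff (v j) s - linearCutoff (u j / 2) s = 1
    rw [linearCutoff_eq_one (hv j) h2, linearCutoff_eq_zero (hu2 j) (by linarith), sub_zero]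

end Cutoff

/-! ### Iterated dilations and their inverses. -/

section SelfSimilar

variable {M : Type*} [MetricSpace M]

theorem IsSelfSimilar.exists_iterates {o : M} (h : IsSelfSimilar o) :
    ∃ R : ℝ, 1 < R ∧ ∃ f g : ℕ → M → M, (∀ m, f m o = o) ∧ (∀ m x, g m (f m x) = x) ∧
      (∀ m x y, dist (f m x) (f m y) = R ^ m * dist x y) ∧
      ∀ m x y, R ^ m * dist (g m x) (g m y) = dist x y := by
  obtain ⟨R, hR, f, hf, hd, ho⟩ := h
  have hdist : ∀ m x y, dist (f^[m] x) (f^[m] y) = R ^ m * dist x y := fun m => by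
    induction m with
    | zero => simp
    | succ m ih =>
      intro x y
      rw [Function.iterate_succ_apply, Function.iterate_succ_apply, ih, hd, pow_succ, mul_assoc]
  choose g hg using fun m => (hf.iterate m).surjective
  refine ⟨R, hR, fun m => f^[m], g, fun m => Function.iterate_fixed ho m,
    fun m x => (hf.iterate m).injective (hg m _), hdist, fun m x y => ?_⟩
  rw [← hdist, hg, hg]

end SelfSimilar

/-! ### Construction of the operators on the free space of a net centred at the fixed point. -/

section Net

variable {M : Type*} [MetricSpace M] {p : Set.Ioc (0 : ℝ) 1} {N : Type u} [MetricSpace N] {e : N}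

/-- Locally finite gluing of maps which vanish at the base point, along cutoff functions, produces
operators between Lipschitz free `p`-spaces. -/
theorem exists_glued_family {o : M} (i : N → M) (hie : i e = o) {K L A : ℝ} (hK : 0 < K)
    (hL : 0 < L) (hA : 0 < A) (hi : ∀ x y, dist (i x) (i y) ≤ K * dist x y)
    (h : ℕ → N → FreePSpace p e) (hh0 : ∀ j, h j e = 0)
    (hh : ∀ j x y, ‖h j x - h j y‖ ≤ L * dist (i x) (i y) ^ (p : ℝ))
    (φ : ℕ → ℝ → ℝ) (hφ : ∀ j, IsCutoff p e A (φ j)) (J : ℝ → Finset ℕ) {B : ℕ}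
    (hJ : ∀ s, (J s).card ≤ B) (hφJ : ∀ s, ∀ j ∉ J s, φ j s = 0) (c : ℕ → ℕ) :
    ∃ (T : ℕ → FreePSpace p e →L[ℝ] FreePSpace p e) (C : ℝ), 0 ≤ C ∧
      C = (B + B) * (A * L) * K ^ (p : ℝ) + 1 ∧
      (∀ n x, T n (freeDelta p e x) = ∑ j ∈ J (dist (i x) o) with c j = n,
        φ j (dist (i x) o) • h j x) ∧
      ∀ (F : Finset ℕ) v, ∑ n ∈ F, ‖T n v‖ ≤ C * ‖v‖ := by
  classical
  have hp := p.2.1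
  set l : N → ℝ := fun x => dist (i x) o with hl
  let f : ℕ → N → FreePSpace p e := fun n x => ∑ j ∈ J (l x) with c j = n, φ j (l x) • h j x
  have hnorm : ∀ j x, ‖h j x‖ ≤ L * l x ^ (p : ℝ) := fun j x => by
    have := hh j x e
    rwa [hh0, sub_zero, hie] at this
  have hterm : ∀ j x y, ‖φ j (l x) • h j x - φ j (l y) • h j y‖ ≤
      A * L * dist (i x) (i y) ^ (p : ℝ) := fun j x y =>
    hφ j hL.le dist_nonneg dist_nonneg (abs_dist_sub_le _ _ _) (hnorm j x) (hnorm j y) (hh j x y)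
  have hsub : ∀ n x (U : Finset ℕ), J (l x) ⊆ U →
      f n x = ∑ j ∈ U with c j = n, φ j (l x) • h j x := fun n x U hU =>
    Finset.sum_subset (Finset.filter_subset_filter _ hU) fun j hj hj' => by
      rw [hφJ, zero_smul]
      exact fun hmem => hj' (Finset.mem_filter.2 ⟨hmem, (Finset.mem_filter.1 hj).2⟩)
  have hf : ∀ (F : Finset ℕ) (x y), ∑ n ∈ F, ‖f n x - f n y‖ ≤
      ((B + B) * (A * L) * K ^ (p : ℝ) + 1) * dist x y ^ (p : ℝ) := fun F x y => by
    set U := J (l x) ∪ J (l y) with hU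
    have hcard : (U.card : ℝ) ≤ B + B := by
      exact_mod_cast (Finset.card_union_le _ _).trans (add_le_add (hJ (l x)) (hJ (l y)))
    calc ∑ n ∈ F, ‖f n x - f n y‖
        ≤ ∑ n ∈ F, ∑ j ∈ U with c j = n, ‖φ j (l x) • h j x - φ j (l y) • h j y‖ := by
          refine Finset.sum_le_sum fun n _ => ?_
          rw [hsub n x U Finset.subset_union_left, hsub n y U Finset.subset_union_right,
            ← Finset.sum_sub_distrib]
          exact norm_sum_le _ _
      -- Each index `j` contributes to one operator only, so summing over the operators costs
      -- nothing beyond the at most 2B active indices.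
      _ ≤ ∑ j ∈ U, ‖φ j (l x) • h j x - φ j (l y) • h j y‖ :=
          Finset.sum_fiberwise_le_sum_of_sum_fiber_nonneg fun n _ =>
            Finset.sum_nonneg fun j _ => norm_nonneg _
      _ ≤ U.card • (A * L * dist (i x) (i y) ^ (p : ℝ)) :=
          Finset.sum_le_card_nsmul _ _ _ fun j _ => hterm j x y
      _ ≤ (B + B) * (A * L * (K * dist x y) ^ (p : ℝ)) := by
          rw [nsmul_eq_mul]
          gcongr
          exact hi x y
      _ = (B + B) * (A * L) * K ^ (p : ℝ) * dist x y ^ (p : ℝ) := by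
          rw [Real.mul_rpow hK.le dist_nonneg]; ring
      _ ≤ _ := by
          have : 0 ≤ dist x y ^ (p : ℝ) := by positivity
          linarith
  have hf0 : ∀ n, f n e = 0 := fun n =>
    Finset.sum_eq_zero fun j _ => by rw [hh0, smul_zero]
  obtain ⟨T, hT, hTb⟩ := FreePSpace.exists_extension_family f hf0
    (C := (B + B) * (A * L) * K ^ (p : ℝ) + 1) (by positivity) hf
  exact ⟨T, _, by positivity, rfl, hT, hTb⟩

/-- A sequence of integers `m j` along which `R ^ m j` is large and grows fast. -/
theorem exists_sparse_exponents {R : ℝ} (hR : 1 < R) (c₀ : ℝ) (c : ℕ → ℝ) :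
    ∃ m : ℕ → ℕ, (∀ j, c₀ ≤ R ^ m j) ∧ ∀ j, c j * R ^ m j ≤ R ^ m (j + 1) := by
  obtain ⟨q₀, hq₀⟩ := pow_unbounded_of_one_lt c₀ hR
  choose q hq using fun j => pow_unbounded_of_one_lt (c j) hR
  refine ⟨fun j => q₀ + ∑ k ∈ Finset.range j, q k, fun j => ?_, fun j => ?_⟩
  · exact hq₀.le.trans (pow_le_pow_right₀ hR.le (Nat.le_add_right _ _))
  · beta_reduce
    rw [Finset.sum_range_succ, ← add_assoc, pow_add _ _ (q j), mul_comm]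
    have : 0 < R := by linarith
    gcongr
    exact (hq j).le

/-- The Lipschitz free `p`-space over a net `i : N → M` in a doubling self-similar space `M`, where
`i` maps the base point of `N` to the centre of `M`. -/
theorem qisomorphic_lpSum_of_net {o : M} (hM : IsDoublingSpace M) (ho : IsSelfSimilar o)
    (p : Set.Ioc (0 : ℝ) 1) (e : N) (i : N → M) (hie : i e = o)
    {a b K : ℝ} (ha : 0 < a) (hb : 0 < b) (hK : 0 < K)
    (hsep : ∀ x y, x ≠ y → a ≤ dist (i x) (i y)) (hdense : ∀ z, ∃ x, dist z (i x) ≤ b)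
    (hi : ∀ x y, dist x y ≤ K * dist (i x) (i y)) (hi' : ∀ x y, dist (i x) (i y) ≤ K * dist x y) :
    QIsomorphic (FreePSpace p e) (LpSum p (FreePSpace p e)) := by
  classical
  have hp := p.2.1
  obtain ⟨r, Cr, hCr, hr, hrδ⟩ :=
    hM.exists_extend_freeDelta p e i ha hb hK hsep hdense hi
  obtain ⟨R, hR, f, g, hfo, hgf, hf, hg⟩ := ho.exists_iterates
  -- The lower bound makes the rounding error `b` at most λ_j a/8, the radius on which r is constant
  -- after rescaling. The growth factor is the sparseness condition 4 · 3 λ_j 2^k a ≤ λ_{j+1} a/2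
  -- for the cutoffs ψ below.
  obtain ⟨m, hm, hm'⟩ := exists_sparse_exponents hR (8 * b / a)
    fun j => 24 * 2 ^ (Nat.unpair j).2
  set lam : ℕ → ℝ := fun j => R ^ m j with hlam
  have hlam0 : ∀ j, 0 < lam j := fun j => pow_pos (by linarith) _
  have hlamb : ∀ j, 8 * b ≤ lam j * a := fun j => (div_le_iff₀ ha).1 (hm j)
  have hgo : ∀ j, g j o = o := fun j => by
    have := hgf j o
    rwa [hfo] at this
  -- Rounding must fix the base point, so that the maps `h j` vanish there.
  have hround : ∀ j x, ∃ y, dist (f (m j) (i x)) (i y) ≤ b ∧ (x = e → y = e) := fun j x => by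
    by_cases hx : x = e
    · refine ⟨e, ?_, fun _ => rfl⟩
      rw [hx, hie, hfo, dist_self]
      exact hb.le
    · obtain ⟨y, hy⟩ := hdense (f (m j) (i x))
      exact ⟨y, hy, fun h => absurd h hx⟩
  choose γ hγ hγe using hround
  have hγlip : ∀ j x y, dist (i (γ j x)) (i (γ j y)) ≤ 2 * (lam j * dist (i x) (i y)) :=
    fun j x y => by
      rcases eq_or_ne x y with rfl | hxy
      · simp
      · have h1 := dist_triangle4 (i (γ j x)) (f (m j) (i x)) (f (m j) (i y)) (i (γ j y))
        rw [hf, dist_comm (i (γ j x)) (f (m j) (i x))] at h1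
        have h2 : lam j * a ≤ lam j * dist (i x) (i y) :=
          mul_le_mul_of_nonneg_left (hsep x y hxy) (hlam0 j).le
        have h3 : lam j * dist (i x) (i y) = R ^ m j * dist (i x) (i y) := rfl
        linarith [hγ j x, hγ j y, hlamb j]
  let h : ℕ → N → FreePSpace p e := fun j x => (lam j)⁻¹ • freeDelta p e (γ j x)
  have hh0 : ∀ j, h j e = 0 := fun j => by
    simp only [h, hγe j e rfl, freeDelta_base, smul_zero]
  have hh : ∀ j x y, ‖h j x - h j y‖ ≤ (K * 2) ^ (p : ℝ) * dist (i x) (i y) ^ (p : ℝ) :=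
    fun j x y => by
      simp only [h]
      rw [← smul_sub, FreePSpace.norm_smul, abs_of_pos (inv_pos.2 (hlam0 j)),
        ← Real.mul_rpow (by positivity) dist_nonneg]
      refine (mul_le_mul_of_nonneg_left (norm_freeDelta_sub_le p e _ _)
        (Real.rpow_nonneg (inv_pos.2 (hlam0 j)).le _)).trans ?_
      rw [← Real.mul_rpow (inv_pos.2 (hlam0 j)).le dist_nonneg]
      refine Real.rpow_le_rpow (mul_nonneg (inv_pos.2 (hlam0 j)).le dist_nonneg) ?_ hp.le
      rw [inv_mul_le_iff₀ (hlam0 j)]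
      calc _ ≤ K * dist (i (γ j x)) (i (γ j y)) := hi _ _
        _ ≤ K * (2 * (lam j * dist (i x) (i y))) := by gcongr; exact hγlip j x y
        _ = _ := by ring
  let H : ℕ → N → FreePSpace p e := fun j y => lam j • r (g (m j) (i y))
  have hH0 : ∀ j, H j e = 0 := fun j => by
    simp only [H]
    rw [hie, hgo, hrδ o e (by rw [hie, dist_self]; positivity), freeDelta_base, smul_zero]
  have hH : ∀ j x y, ‖H j x - H j y‖ ≤ Cr * dist (i x) (i y) ^ (p : ℝ) := fun j x y => by
    simp only [H]
    rw [← smul_sub, FreePSpace.norm_smul, abs_of_pos (hlam0 j), ← hg (m j) (i x) (i y),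
      Real.mul_rpow (hlam0 j).le dist_nonneg, mul_left_comm]
    exact mul_le_mul_of_nonneg_left (hr _ _) (Real.rpow_nonneg (hlam0 j).le _)
  obtain ⟨φ, Z, hφ, hZ, hφZ, hφ1, hφs⟩ := exists_dyadic_partition p e ha
  obtain ⟨ψ, J, hψ, hJ, hψJ, hψ1⟩ := exists_sparse_cutoffs p e
    (u := fun j => lam j * a / 2) (v := fun j => lam j * (3 * (2 ^ (Nat.unpair j).2 * a)))
    (fun j => half_pos (mul_pos (hlam0 j) ha))
    (fun j => by
      have h1 : (1 : ℝ) ≤ 2 ^ (Nat.unpair j).2 := one_le_pow₀ one_le_two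
      have h2 := mul_pos (hlam0 j) ha
      nlinarith)
    (fun j => by
      have h1 : 24 * 2 ^ (Nat.unpair j).2 * lam j ≤ lam (j + 1) := hm' j
      nlinarith)
  obtain ⟨T, CT, hCT, -, hTδ, hTb⟩ := exists_glued_family i hie hK hCr (by norm_num : (0 : ℝ) < 6)
    hi' H hH0 hH ψ hψ J hJ hψJ fun j => (Nat.unpair j).1
  -- Only one operator is wanted for each `n`: the constant colouring collects all terms in index 0.
  have hSex := fun n => exists_glued_family i hie hK
    (show 0 < (K * 2) ^ (p : ℝ) by positivity) (by norm_num : (0 : ℝ) < 6) hi'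
    (fun k => h (Nat.pair n k)) (fun k => hh0 _) (fun k => hh _) φ hφ Z hZ hφZ fun _ => 0
  choose S CS hCS hCS' hSδ hSb using hSex
  -- Heart of the construction: wherever φ_k is nonzero, the dilated and rounded point lies where
  -- ψ_j = 1 and all other cutoffs vanish, and contracting it gives a point within a/8 of `i x`,
  -- where r equals δ(x). The base point lies in no annulus and is treated separately.
  have hkey : ∀ n n' k x, φ k (dist (i x) o) ≠ 0 →
      T n' (h (Nat.pair n k) x) = if n = n' then freeDelta p e x else 0 := fun n n' k x hk => by
    rcases eq_or_ne x e with rfl | hx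
    · rw [hh0, map_zero, freeDelta_base, ite_self]
    set j := Nat.pair n k with hj
    have hj1 : (Nat.unpair j).1 = n := by rw [hj, Nat.unpair_pair]
    have hj2 : (Nat.unpair j).2 = k := by rw [hj, Nat.unpair_pair]
    set s := dist (i (γ j x)) o with hs
    have hfx : dist (f (m j) (i x)) o = lam j * dist (i x) o := by
      conv_lhs => rw [← hfo (m j)]
      exact hf _ _ _
    have hxa : lam j * a ≤ lam j * dist (i x) o :=
      mul_le_mul_of_nonneg_left (hie ▸ hsep x e hx) (hlam0 j).le
    have hxk : lam j * dist (i x) o ≤ lam j * (2 * (2 ^ k * a)) :=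
      mul_le_mul_of_nonneg_left (hφs k _ hk) (hlam0 j).le
    have hak : lam j * a ≤ lam j * (2 ^ k * a) :=
      mul_le_mul_of_nonneg_left (le_mul_of_one_le_left ha.le (one_le_pow₀ one_le_two))
        (hlam0 j).le
    have hs1 : lam j * a / 2 ≤ s := by
      have := dist_triangle (f (m j) (i x)) (i (γ j x)) o
      linarith [hγ j x, hlamb j]
    have hs2 : s ≤ lam j * (3 * (2 ^ (Nat.unpair j).2 * a)) := by
      rw [hj2]
      have := dist_triangle_left (i (γ j x)) o (f (m j) (i x))
      linarith [hγ j x, hlamb j]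
    have hψ1' : ψ j s = 1 := hψ1 j s hs1 hs2
    have hjJ : j ∈ J s := by
      by_contra hjJ
      rw [hψJ s j hjJ] at hψ1'
      exact zero_ne_one hψ1'
    have hJs : J s = {j} := (Finset.eq_singleton_iff_unique_mem).2
      ⟨hjJ, fun j' hj' => Finset.card_le_one.1 (hJ s) j' hj' j hjJ⟩
    have hrx : r (g (m j) (i (γ j x))) = freeDelta p e x := by
      refine hrδ _ _ ?_
      have h1 := hg (m j) (i (γ j x)) (f (m j) (i x))
      rw [hgf, dist_comm (i (γ j x))] at h1
      have h2 : lam j * dist (g (m j) (i (γ j x))) (i x) ≤ lam j * (a / 8) := by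
        have := hγ j x
        have h3 : lam j * dist (g (m j) (i (γ j x))) (i x) =
          R ^ m j * dist (g (m j) (i (γ j x))) (i x) := rfl
        linarith [hlamb j]
      exact le_of_mul_le_mul_left h2 (hlam0 j)
    change T n' ((lam j)⁻¹ • freeDelta p e (γ j x)) = _
    rw [map_smul, hTδ, ← hs, hJs, Finset.sum_filter, Finset.sum_singleton, hj1, hψ1', one_smul]
    split_ifs
    · change (lam j)⁻¹ • lam j • r (g (m j) (i (γ j x))) = _
      rw [hrx, inv_smul_smul₀ (hlam0 j).ne']
    · exact smul_zero _
  have hcomp : ∀ n n' x, T n' (S n 0 (freeDelta p e x)) = if n = n' then freeDelta p e x else 0 :=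
    fun n n' x => by
      rw [hSδ, Finset.filter_true_of_mem fun _ _ => rfl, map_sum]
      have : ∀ k ∈ Z (dist (i x) o), T n' (φ k (dist (i x) o) • h (Nat.pair n k) x) =
          φ k (dist (i x) o) • if n = n' then freeDelta p e x else 0 := fun k _ => by
        rw [map_smul]
        by_cases hk : φ k (dist (i x) o) = 0
        · rw [hk, zero_smul, zero_smul]
        · rw [hkey n n' k x hk]
      rw [Finset.sum_congr rfl this, ← Finset.sum_smul, hφ1, one_smul]
  refine FreePSpace.qisomorphic_lpSum (fun n => S n 0) T (C := CS 0) (hCS 0) hCT (fun n v => ?_)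
    hTb (fun n v => ?_) fun n' n v hn => ?_
  · have := hSb n {0} v
    -- The explicit gluing constant does not involve the maps `h j`, hence is the same for every
    -- `n`; this is the uniform bound on the S_n.
    rw [Finset.sum_singleton, hCS' n, ← hCS' 0] at this
    exact this
  · have : (T n).comp (S n 0) = ContinuousLinearMap.id ℝ _ :=
      FreePSpace.ext_clm fun x => by simpa using hcomp n n x
    exact congrArg (fun A => A v) this
  · have : (T n').comp (S n 0) = 0 :=
      FreePSpace.ext_clm fun x => by simpa [hn.symm] using hcomp n n' x
    exact congrArg (fun A => A v) this

end Net

/-! ### Arbitrary nets and base points, finite-dimensional spaces and integer lattices. -/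

section Nets

/-- The centre `o` need not lie in `N`, and `e` may be far from it. Replace the only net point x₁
that can be within a/2 of `o` by `o` itself, and relabel so that `e` is the point sent to `o`.
Points move by a bounded amount, and bounded perturbations of separated sets are bi-Lipschitz. -/
theorem qisomorphic_lpSum_of_isMetricNet {M : Type u} [MetricSpace M] {o : M}
    (hM : IsDoublingSpace M) (ho : IsSelfSimilar o) {N : Set M} (hN : IsMetricNet N)
    (p : Set.Ioc (0 : ℝ) 1) (e : N) :
    QIsomorphic (FreePSpace p e) (LpSum p (FreePSpace p e)) := by
  classical
  obtain ⟨a, b, ha, hb, hsep, hdense⟩ := hN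
  have hsep' : ∀ x y : N, x ≠ y → a ≤ dist (x : M) y := fun x y hxy =>
    hsep x x.2 y y.2 fun h => hxy (Subtype.ext h)
  obtain ⟨x₁, hx₁⟩ : ∃ x₁ : N, ∀ x : N, x ≠ x₁ → a / 2 ≤ dist o (x : M) := by
    by_cases h : ∃ x₁ : N, dist o (x₁ : M) < a / 2
    · obtain ⟨x₁, hx₁⟩ := h
      refine ⟨x₁, fun x hx => ?_⟩
      linarith [hsep' x x₁ hx, dist_triangle_left (x : M) x₁ o]
    · push Not at h
      exact ⟨e, fun x _ => h x⟩
  let σ : Equiv.Perm N := Equiv.swap e x₁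
  have hσ : ∀ x, x ≠ e → σ x ≠ x₁ := fun x hx h => hx (by
    rw [← Equiv.swap_apply_left e x₁] at h
    exact σ.injective h)
  let i : N → M := fun x => if x = e then o else σ x
  have hie : i e = o := if_pos rfl
  have hin : ∀ x, x ≠ e → i x = σ x := fun x hx => if_neg hx
  set c : ℝ := dist o (x₁ : M) + dist (e : M) x₁ with hc
  have hc0 : 0 ≤ c := by positivity
  have hc1 : dist o (x₁ : M) ≤ c := le_add_of_nonneg_right dist_nonneg
  have hic : ∀ x : N, dist (i x) x ≤ c := fun x => by
    by_cases hx : x = e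
    · rw [hx, hie]
      exact dist_triangle_right _ _ _
    · rw [hin x hx]
      by_cases hx' : x = x₁
      · rw [hx']
        simp only [σ, Equiv.swap_apply_right]
        exact le_add_of_nonneg_left dist_nonneg
      · simp only [σ, Equiv.swap_apply_of_ne_of_ne hx hx', dist_self]
        exact hc0
  have hisep : ∀ x y, x ≠ y → a / 2 ≤ dist (i x) (i y) := fun x y hxy => by
    by_cases hx : x = e
    · have hy : y ≠ e := fun h => hxy (hx.trans h.symm)
      rw [hx, hie, hin y hy]
      exact hx₁ _ (hσ y hy)
    · by_cases hy : y = e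
      · rw [hy, hie, hin x hx, dist_comm]
        exact hx₁ _ (hσ x hx)
      · rw [hin x hx, hin y hy]
        linarith [hsep' _ _ (σ.injective.ne hxy)]
  have hidense : ∀ z, ∃ x, dist z (i x) ≤ b + c := fun z => by
    obtain ⟨y, hy, hzy⟩ := hdense z
    refine ⟨σ ⟨y, hy⟩, ?_⟩
    by_cases h : σ ⟨y, hy⟩ = e
    · have hy' : (⟨y, hy⟩ : N) = x₁ := by
        rw [← Equiv.swap_apply_right e x₁] at h
        exact σ.injective h
      rw [h, hie]
      have h1 := dist_triangle_right z o (x₁ : M)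
      rw [← hy'] at h1
      rw [← hy'] at hc1
      linarith
    · rw [hin _ h]
      simp only [σ, Equiv.swap_apply_self]
      linarith
  -- On distances at least a/2, an additive error 2c is a multiplicative one.
  have hbd : ∀ s t : ℝ, a / 2 ≤ t → s ≤ t + 2 * c → s ≤ (1 + 4 * c / a) * t := fun s t h1 h2 => by
    have h3 : 2 * c ≤ 4 * c / a * t := by
      calc 2 * c = 4 * c / a * (a / 2) := by field_simp; ring
        _ ≤ 4 * c / a * t := by gcongr
    linarith
  refine qisomorphic_lpSum_of_net hM ho p e i hie (K := 1 + 4 * c / a) (half_pos ha)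
    (by positivity : 0 < b + c) (by positivity) hisep hidense (fun x y => ?_) fun x y => ?_
  · rcases eq_or_ne x y with rfl | hxy
    · simp
    · refine hbd _ _ (hisep x y hxy) ?_
      have := dist_triangle4 (x : M) (i x) (i y) y
      rw [dist_comm (x : M) (i x)] at this
      rw [Subtype.dist_eq]
      linarith [hic x, hic y]
  · rcases eq_or_ne x y with rfl | hxy
    · simp
    · refine hbd _ _ ((half_le_self ha.le).trans (hsep' x y hxy)) ?_
      have := dist_triangle4 (i x) (x : M) y (i y)
      rw [dist_comm (y : M)] at this
      rw [Subtype.dist_eq]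
      linarith [hic x, hic y]

section FiniteDimensional

variable (E : Type*) [NormedAddCommGroup E] [NormedSpace ℝ E]

theorem isSelfSimilar_zero : IsSelfSimilar (0 : E) :=
  ⟨2, one_lt_two, fun x => (2 : ℝ) • x,
    (Homeomorph.smulOfNeZero (2 : ℝ) two_ne_zero : E ≃ₜ E).bijective,
    fun x y => by rw [dist_smul₀, Real.norm_two], smul_zero _⟩

/-- By compactness finitely many balls of radius 1/2 cover the unit ball; translation and scaling
carry this cover to every ball. -/
theorem isDoublingSpace_of_finiteDimensional [FiniteDimensional ℝ E] : IsDoublingSpace E := by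
  classical
  have : ProperSpace E := FiniteDimensional.proper_real E
  obtain ⟨t, -, htf, ht⟩ := (isCompact_closedBall (0 : E) 1).finite_cover_balls
    (by norm_num : (0 : ℝ) < 1 / 2)
  refine ⟨htf.toFinset.card, fun x r hr => ⟨htf.toFinset.image fun y => x + r • y,
    Finset.card_image_le, fun z hz => ?_⟩⟩
  have hz' : r⁻¹ • (z - x) ∈ Metric.closedBall (0 : E) 1 := by
    rw [mem_closedBall_zero_iff, norm_smul, norm_inv, Real.norm_of_nonneg hr.le,
      inv_mul_le_iff₀ hr, mul_one, ← dist_eq_norm]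
    exact hz
  obtain ⟨y, hy, hzy⟩ := Set.mem_iUnion₂.1 (ht hz')
  refine Set.mem_iUnion₂.2 ⟨x + r • y, Finset.mem_image.2 ⟨y, by simpa using hy, rfl⟩, ?_⟩
  have h1 : z - (x + r • y) = r • (r⁻¹ • (z - x) - y) := by
    rw [smul_sub, smul_inv_smul₀ hr.ne']; abel
  rw [Metric.mem_ball, dist_eq_norm] at hzy
  rw [Metric.mem_closedBall, dist_eq_norm, h1, norm_smul, Real.norm_of_nonneg hr.le]
  calc r * ‖r⁻¹ • (z - x) - y‖ ≤ r * (1 / 2) := by gcongr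
    _ = r / 2 := by ring

end FiniteDimensional

theorem isMetricNet_euclideanIntLattice (d : ℕ) : IsMetricNet (euclideanIntLattice d) := by
  -- Coordinatewise rounding moves a point by at most √d; the added 1 keeps the constant positive
  -- when d = 0.
  refine ⟨1, √d + 1, one_pos, by positivity, fun x hx y hy hxy => ?_, fun x => ?_⟩
  · obtain ⟨k, hk⟩ : ∃ k, x k ≠ y k := by
      by_contra! h
      exact hxy (by ext k; exact h k)
    obtain ⟨m, hm⟩ := hx k
    obtain ⟨n, hn⟩ := hy k
    have h0 : ∀ m n : ℤ, (m : ℝ) ≠ n → (1 : ℝ) ≤ |(m : ℝ) - n| := fun m n hmn => by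
      exact_mod_cast Int.one_le_abs (sub_ne_zero.2 (Int.cast_injective.ne_iff.1 hmn))
    have h1 : 1 ≤ |x k - y k| := by
      rw [hm, hn] at hk ⊢
      exact h0 m n hk
    refine h1.trans ?_
    rw [dist_eq_norm]
    exact PiLp.norm_apply_le (x - y) k
  · refine ⟨WithLp.toLp 2 fun k => (round (x k) : ℝ), fun k => ⟨round (x k), rfl⟩, ?_⟩
    rw [EuclideanSpace.dist_eq]
    have h : ∑ k, dist (x k) (round (x k) : ℝ) ^ 2 ≤ d := by
      calc _ ≤ ∑ _k : Fin d, (1 : ℝ) := Finset.sum_le_sum fun k _ => by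
            have := abs_sub_round (x k)
            rw [Real.dist_eq]
            exact pow_le_one₀ (abs_nonneg _) (by linarith)
        _ = d := by simp
    exact (Real.sqrt_le_sqrt h).trans (by linarith)

/-- Here the lattice is a type of its own with the maximum metric. Translation by `-e` embeds it
isometrically into ℝ^d with the base point at the origin, so no perturbation is needed. -/
theorem qisomorphic_lpSum_intLattice (d : ℕ) (p : Set.Ioc (0 : ℝ) 1) (e : Fin d → ℤ) :
    QIsomorphic (FreePSpace p e) (LpSum p (FreePSpace p e)) := by
  let i : (Fin d → ℤ) → (Fin d → ℝ) := fun x k => (x k : ℝ) - e k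
  have hi : ∀ x y, dist (i x) (i y) = dist x y := fun x y => by
    refine le_antisymm ((dist_pi_le_iff dist_nonneg).2 fun k => ?_)
      ((dist_pi_le_iff dist_nonneg).2 fun k => ?_)
    · refine le_trans (le_of_eq ?_) (dist_le_pi_dist x y k)
      simp [i, Real.dist_eq, Int.dist_eq]
    · refine le_trans (le_of_eq ?_) (dist_le_pi_dist (i x) (i y) k)
      simp [i, Real.dist_eq, Int.dist_eq]
  refine qisomorphic_lpSum_of_net (isDoublingSpace_of_finiteDimensional (Fin d → ℝ))
    (isSelfSimilar_zero _) p e i (by funext k; simp [i]) one_pos one_pos one_pos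
    (fun x y hxy => ?_) (fun z => ⟨fun k => round (z k) + e k, ?_⟩)
    (fun x y => by rw [hi, one_mul]) fun x y => by rw [hi, one_mul]
  · obtain ⟨k, hk⟩ := Function.ne_iff.1 hxy
    rw [hi]
    refine le_trans ?_ (dist_le_pi_dist x y k)
    rw [Int.dist_eq]
    exact_mod_cast Int.one_le_abs (sub_ne_zero.2 hk)
  · refine (dist_pi_le_iff zero_le_one).2 fun k => ?_
    have := abs_sub_round (z k)
    simp only [i, Real.dist_eq, Int.cast_add, add_sub_cancel_right]
    linarith

end Nets

theorem corollary5 :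
    (∀ (M : Type u) [MetricSpace M] (o : M), IsDoublingSpace M → IsSelfSimilar o →
      ∀ N : Set M, IsMetricNet N → ∀ (p : Set.Ioc (0 : ℝ) 1) (e : N),
        QIsomorphic (FreePSpace p e) (LpSum p (FreePSpace p e))) ∧
    (∀ (E : Type u) [NormedAddCommGroup E] [NormedSpace ℝ E] [FiniteDimensional ℝ E]
      (N : Set E), IsMetricNet N → ∀ (p : Set.Ioc (0 : ℝ) 1) (e : N),
        QIsomorphic (FreePSpace p e) (LpSum p (FreePSpace p e))) ∧
    (∀ (d : ℕ) (p : Set.Ioc (0 : ℝ) 1) (e : euclideanIntLattice d),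
      QIsomorphic (FreePSpace p e) (LpSum p (FreePSpace p e))) ∧
    (∀ (d : ℕ) (p : Set.Ioc (0 : ℝ) 1) (e : Fin d → ℤ),
      QIsomorphic (FreePSpace p e) (LpSum p (FreePSpace p e))) :=
  ⟨fun _ _ _ hM ho _ hN p e => qisomorphic_lpSum_of_isMetricNet hM ho hN p e,
    fun E _ _ _ _ hN p e => qisomorphic_lpSum_of_isMetricNet
      (isDoublingSpace_of_finiteDimensional E) (isSelfSimilar_zero E) hN p e,
    fun d p e => qisomorphic_lpSum_of_isMetricNet
      (isDoublingSpace_of_finiteDimensional (EuclideanSpace ℝ (Fin d)))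
      (isSelfSimilar_zero _) (isMetricNet_euclideanIntLattice d) p e,
    fun d p e => qisomorphic_lpSum_intLattice d p e⟩

end
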